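/- \textbf{Setting.} A base station with $M\ge 1$ antennas serves $M$ single-antenna users by zero-forcing (ZF) precoding over blocks of $T$ symbols. Let $P>0$, $f\in(0,1]$, $\alpha>0$. In a block the channel matrix $H$ (row $h_k$ for user $k$) has i.i.d. $\mathcal{CN}(0,1)$ entries and is the same for uplink and downlink. Each user in turn sends training pilots of power $fP$, which the base station receives at its antennas in independent $\mathcal{CN}(0,1)$ noise; a cycle is $M$ consecutive symbols in which every user sends one pilot. After $\beta$ cycles the base station has the MMSE estimate $\widehat H_\beta=\mathbb E[H\mid\text{pilots of the first }\beta\text{ cycles}]$, and uses the unit-norm ZF beams $\hat v_1,\dots,\hat v_M$, the normalized columns of $\widehat H_\beta^{-1}$ (fixed unit vectors if $\widehat H_\beta$ is singular), with power $P/M$ each. If additional interference of power $I$ is present, the rate of user $k$ is $$R(\beta,I)=\mathbb E\left[\log\left(1+\frac{\frac PM|h_k\hat v_k|^2}{1+\sum_{j\ne k}\frac PM|h_k\hat v_j|^2+I}\right)\right]$$ (natural logarithm). Put $R_{\mathrm{DATA}}(\beta)=R(\beta,0)$ and $R_{\mathrm{INI}}(\beta)=R(\beta,\alpha fP)$ (inter-node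 interference), and let $R^{\mathrm{ZF}}$ be the rate with $I=0$ when $\widehat H_\beta$ is replaced by $H$ (genie-aided full CSI). The spectral efficiency per user of continuously adaptive beamforming (CAB) with training length $\tau\in[0,T)$ is, with $n=\lfloor \tau/M\rfloor$ complete cycles, $$AR_{\mathrm{CAB}}(\tau)=\frac{T-\tau}{T}R_{\mathrm{DATA}}(n)+\frac1T\sum_{j=2}^{n}\Big[R_{\mathrm{DATA}}(j-1)+(M-1)R_{\mathrm{INI}}(j-1)\Big].$$ Let $$\widetilde{\Delta R}_{\mathrm{INI}}=\log\left(\frac{1+\alpha fP}{1+\frac{\alpha fP}{1+P/M}}\right),\qquad c=\frac{f\,\widetilde{\Delta R}_{\mathrm{INI}}}{M},\qquad \widetilde T^*_{\mathrm{CAB}}=\frac{\sqrt{4cT+1}-1}{2c}.$$ \textbf{Theorem.} For every $T\ge1$ the function $AR_{\mathrm{CAB}}$ has a maximizer $T^*_{\mathrm{CAB}}$ on $[0,T)$, and for every maximizer $$R^{\mathrm{ZF}}-AR_{\mathrm{CAB}}(T^*_{\mathrm{CAB}})\le R^{\mathrm{ZF}}-AR_{\mathrm{CAB}}(\widetilde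 T^*_{\mathrm{CAB}})\le 2\sqrt{\frac{M\,\widetilde{\Delta R}_{\mathrm{INI}}}{fT}}+o\left(\frac1{\sqrt T}\right),$$ where the $o(1/\sqrt T)$ is as $T\to\infty$ with $M,P,f,\alpha$ fixed. -/

import Mathlib

open MeasureTheory ProbabilityTheory

namespace CAB

noncomputable section

/-- The circularly symmetric complex Gaussian law `CN(0,1)`: independent real and imaginary
parts, each of law `N(0, 1/2)`. -/
def stdComplexGaussian : Measure ℂ :=
  ((gaussianReal 0 (1 / 2)).prod (gaussianReal 0 (1 / 2))).map Complex.measurableEquivRealProd.symm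

instance : IsProbabilityMeasure stdComplexGaussian :=
  Measure.isProbabilityMeasure_map Complex.measurableEquivRealProd.symm.measurable.aemeasurable

/-- The law of an `M × M` array with i.i.d. `CN(0,1)` entries. -/
def gaussianArray (M : ℕ) : Measure (Fin M → Fin M → ℂ) :=
  Measure.pi fun _ => Measure.pi fun _ => stdComplexGaussian

instance (M : ℕ) : IsProbabilityMeasure (gaussianArray M) := by
  unfold gaussianArray; infer_instance

/-- Outcomes relevant after `β` training cycles of one fading block: the channel coefficients
(`ω.1 k a` is the coefficient between user `k` and base-station antenna `a`, the same in both
directions by reciprocity) and the noise at the base station (`ω.2 b k a` is the noise at antenna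
`a` while user `k` sends its pilot in cycle `b`). -/
abbrev Block (M β : ℕ) : Type := (Fin M → Fin M → ℂ) × (Fin β → Fin M → Fin M → ℂ)

/-- Rayleigh fading and unit-variance complex Gaussian noise, all entries independent. -/
def blockLaw (M β : ℕ) : Measure (Block M β) :=
  (gaussianArray M).prod (Measure.pi fun _ => gaussianArray M)

instance (M β : ℕ) : IsProbabilityMeasure (blockLaw M β) := by
  unfold blockLaw; infer_instance

/-- What the base station observes: in each of the `β` cycles each user, alone in its slot,
sends one pilot of power `f P`. -/
def pilots (M β : ℕ) (P f : ℝ) (ω : Block M β) : Fin β → Fin M → Fin M → ℂ :=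
  fun b k a => (Real.sqrt (f * P) : ℂ) * ω.1 k a + ω.2 b k a

/-- The MMSE estimate of the channel matrix: the conditional mean given the pilots. -/
def mmseEstimate (M β : ℕ) (P f : ℝ) (ω : Block M β) : Matrix (Fin M) (Fin M) ℂ :=
  Matrix.of fun k a =>
    ((blockLaw M β)[fun ω' : Block M β => ω'.1 k a |
      MeasurableSpace.comap (pilots M β P f) inferInstance]) ω

open Classical in
/-- The unit-norm zero-forcing beam for user `j`, computed from a channel matrix `G` (row `k` is
the channel of user `k`): the normalized `j`-th column of `G⁻¹`. If `G` is singular, in particular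
if no pilot has been received and `G = 0`, the `j`-th standard unit vector is used. -/
def zfBeam {M : ℕ} (G : Matrix (Fin M) (Fin M) ℂ) (j : Fin M) : EuclideanSpace ℂ (Fin M) :=
  if IsUnit G.det then
    ((‖WithLp.toLp 2 (fun a => G⁻¹ a j)‖⁻¹ : ℝ) : ℂ) • WithLp.toLp 2 (fun a => G⁻¹ a j)
  else EuclideanSpace.single j 1

/-- The power gain `|h_k v_j|²` of the beam `v_j` at user `k`, when the true channel matrix is `H`
and the beams are computed from `G`. -/
def beamGain {M : ℕ} (H G : Matrix (Fin M) (Fin M) ℂ) (k j : Fin M) : ℝ :=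
  ‖∑ a, H k a * zfBeam G j a‖ ^ 2

/-- The signal-to-interference-and-noise ratio of user `k`: true channel `H`, zero-forcing from
`G`, power `P / M` per beam, unit noise power, and extra interference of power `I`. -/
def sinr {M : ℕ} (P I : ℝ) (H G : Matrix (Fin M) (Fin M) ℂ) (k : Fin M) : ℝ :=
  (P / M * beamGain H G k k) /
    (1 + (∑ j ∈ Finset.univ.erase k, P / M * beamGain H G k j) + I)

/-- `R^ZF`: ergodic rate (in nats) of user `k` if the base station knows the channel perfectly. -/
def rateZF (M : ℕ) (P : ℝ) (k : Fin M) : ℝ :=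
  ∫ H, Real.log (1 + sinr P 0 (Matrix.of H) (Matrix.of H) k) ∂(gaussianArray M)

/-- Ergodic rate (in nats) of user `k` if the base station has `β` pilots of each user, while
inter-node interference of power `I` is present. -/
def rate (M : ℕ) (P f I : ℝ) (β : ℕ) (k : Fin M) : ℝ :=
  ∫ ω, Real.log (1 + sinr P I (Matrix.of ω.1) (mmseEstimate M β P f ω) k) ∂(blockLaw M β)

/-- `R_DATA`, which is also the rate in the symbol where user `k` itself sends its pilot: no
inter-node interference. -/
def rateData (M : ℕ) (P f : ℝ) (β : ℕ) (k : Fin M) : ℝ := rate M P f 0 β k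

/-- `R_INI`: the rate in the symbols where another user sends its pilot. -/
def rateINI (M : ℕ) (P f α : ℝ) (β : ℕ) (k : Fin M) : ℝ := rate M P f (α * f * P) β k

/-- The spectral efficiency of continuously adaptive beamforming, for user `k`, in a block of `T`
symbols of which the first `τ` are used for training. There are `⌊τ / M⌋` complete cycles; nothing
is received in cycle `1` nor in an incomplete cycle at the end of the training phase. -/
def arCAB (M : ℕ) (P f α : ℝ) (k : Fin M) (T : ℕ) (τ : ℝ) : ℝ :=
  (T - τ) / T * rateData M P f ⌊τ / M⌋₊ k +
    1 / T * ∑ j ∈ Finset.Icc 2 ⌊τ / M⌋₊,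
      (rateData M P f (j - 1) k + (M - 1) * rateINI M P f α (j - 1) k)

/-- The limiting rate loss caused by inter-node interference. -/
def lossINI (M : ℕ) (P f α : ℝ) : ℝ :=
  Real.log ((1 + α * f * P) / (1 + α * f * P / (1 + P / M)))

/-- The approximately optimal training length. -/
def trainLen (M : ℕ) (P f α : ℝ) (T : ℕ) : ℝ :=
  let c : ℝ := f * lossINI M P f α / M
  (Real.sqrt (4 * c * T + 1) - 1) / (2 * c)

/-- `τ` maximizes the spectral efficiency over all training lengths in `[0, T)`. -/
def IsOptimalLen (M : ℕ) (P f α : ℝ) (k : Fin M) (T : ℕ) (τ : ℝ) : Prop :=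
  τ ∈ Set.Ico (0 : ℝ) T ∧ IsMaxOn (arCAB M P f α k T) (Set.Ico (0 : ℝ) T) τ

end

end CAB

namespace CAB

/-! The rate loss at a given number β of cycles is bounded first; the training length is optimized
afterwards. Signal and noise have the same Gaussian law, so the MMSE estimate is a multiple of the
sum of the pilots (`mmseEstimate_ae_eq`). Its error is independent of the pilots
(`indepFun_estErr_obs`) and has `1 / (1 + β f P)` times the channel covariance (`variance_estErr`).
Zero-forcing cancels the estimated part of the interference, so only the error leaks. Its mean total
power is at most `1 / (f β)` (`integral_leak`). The user's own beam is, up to phase, determined by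
the other rows of the estimate. It is therefore independent of the user's own channel, and the
useful gain has the same law as under perfect knowledge (`map_ownAmp`, `rateZF_eq`). Leakage of
power J costs at most J nats. The additional loss from inter-node interference is concave in the
gain, hence at most its value at the mean gain (`integral_log_sub_le`). Together these give
`rateZF_sub_rate_le`. Summed over the cycles, with `Δ = lossINI`, training length x loses at most
about `M / (f x) + x Δ / T`, plus edge effects of order `1 / T` and the accumulated estimation
losses during training, of order `√x / T` (`rateZF_sub_arCAB_le`). The two main terms balance at `x
= √(T / c)`, where each equals `√(M Δ / (f T))`; `trainLen` differs from this x by at most a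
constant. The rest is `o(1 / √T)`. -/

/-! ### The complex Gaussian law: joint Gaussianity, unit-norm combinations, moments -/

open Complex in
lemma charFun_stdComplexGaussian (t : ℂ) :
    charFun stdComplexGaussian t = cexp (-(‖t‖ ^ 2 / 4 : ℝ)) := by
  have h : stdComplexGaussian = ((gaussianReal 0 (1 / 2)).prod (gaussianReal 0 (1 / 2))).map
      Complex.measurableEquivRealProd.symm := rfl
  rw [charFun_apply, h, integral_map_equiv]
  have h2 : ∀ x : ℝ × ℝ, cexp (inner ℝ (Complex.measurableEquivRealProd.symm x) t * I) =
      cexp (t.re * x.1 * I) * cexp (t.im * x.2 * I) := by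
    intro x
    rw [← Complex.exp_add, Complex.inner]
    congr 1
    simp [Complex.measurableEquivRealProd]
    ring
  simp_rw [h2]
  rw [integral_prod_mul (fun x : ℝ => cexp (t.re * x * I)) (fun x : ℝ => cexp (t.im * x * I)),
    ← charFun_apply_real, ← charFun_apply_real, charFun_gaussianReal, charFun_gaussianReal,
    ← Complex.exp_add]
  congr 1
  rw [← Complex.normSq_eq_norm_sq, Complex.normSq_apply]
  push_cast
  simp
  ring

instance : IsGaussian stdComplexGaussian := by
  have h : stdComplexGaussian = ((gaussianReal 0 (1 / 2)).prod (gaussianReal 0 (1 / 2))).map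
    Complex.equivRealProdCLM.symm := rfl
  rw [h]
  infer_instance

instance {ι : Type*} [Fintype ι] {E : Type*} [NormedAddCommGroup E] [NormedSpace ℝ E]
    [CompleteSpace E] [MeasurableSpace E] [BorelSpace E] [SecondCountableTopology E]
    (μ : Measure E) [IsGaussian μ] : IsGaussian (Measure.pi fun _ : ι => μ) := by
  have hind : iIndepFun (fun (i : ι) (ω : ι → E) => ω i) (Measure.pi fun _ : ι => μ) :=
    iIndepFun_pi (μ := fun _ : ι => μ) (X := fun (_ : ι) (x : E) => x)
      (fun i => measurable_id.aemeasurable)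
  have h1 : ∀ i : ι, HasGaussianLaw (fun ω : ι → E => ω i) (Measure.pi fun _ : ι => μ) := fun i =>
    ⟨by
      have h2 := (measurePreserving_eval (fun _ : ι => μ) i).map_eq
      change IsGaussian ((Measure.pi fun _ : ι => μ).map (Function.eval i))
      rw [h2]
      infer_instance⟩
  simpa using (iIndepFun.hasGaussianLaw h1 hind).isGaussian_map

instance (M : ℕ) : IsGaussian (gaussianArray M) := by
  unfold gaussianArray; infer_instance

instance (M β : ℕ) : IsGaussian (blockLaw M β) := by
  unfold blockLaw; infer_instance

/-- A unit-norm linear combination of i.i.d. `CN(0,1)` variables is `CN(0,1)`. -/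
lemma map_sum_mul_pi_stdComplexGaussian {ι : Type*} [Fintype ι] (v : ι → ℂ)
    (hv : ∑ i, ‖v i‖ ^ 2 = 1) :
    (Measure.pi fun _ : ι => stdComplexGaussian).map (fun h => ∑ i, h i * v i) =
      stdComplexGaussian := by
  have hind : iIndepFun (fun (i : ι) (h : ι → ℂ) => h i * v i)
      (Measure.pi fun _ : ι => stdComplexGaussian) :=
    iIndepFun_pi (X := fun i x => x * v i) (fun i => by fun_prop)
  have : IsProbabilityMeasure ((Measure.pi fun _ : ι => stdComplexGaussian).map
      (fun h => ∑ i, h i * v i)) := Measure.isProbabilityMeasure_map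
      (by fun_prop : Measurable fun h : ι → ℂ => ∑ i, h i * v i).aemeasurable
  refine Measure.ext_of_charFun ?_
  rw [hind.charFun_map_fun_sum_eq_prod (fun i =>
    (by fun_prop : Measurable fun h : ι → ℂ => h i * v i).aemeasurable)]
  ext t
  rw [Finset.prod_apply]
  have h1 : ∀ i, charFun ((Measure.pi fun _ : ι => stdComplexGaussian).map
      (fun h => h i * v i)) t = Complex.exp (-(‖v i‖ ^ 2 * ‖t‖ ^ 2 / 4 : ℝ)) := by
    intro i
    have h2 : (Measure.pi fun _ : ι => stdComplexGaussian).map (fun h => h i * v i) =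
        stdComplexGaussian.map (fun z => z * v i) := by
      have h3 := measurePreserving_eval (fun _ : ι => stdComplexGaussian) i
      conv_rhs => rw [← h3.map_eq]
      rw [Measure.map_map (by fun_prop) h3.measurable]
      rfl
    rw [h2, charFun_apply, integral_map (by fun_prop) (by fun_prop)]
    -- The factor `v i` passes to the argument as its conjugate. Since the characteristic function
    -- sees only `‖t‖`, only `‖v i‖` survives.
    have h3 : ∀ z, inner ℝ (z * v i) t = inner ℝ z (t * (starRingEnd ℂ) (v i)) := by
      intro z
      simp [Complex.inner]
      ring
    simp_rw [h3]
    rw [← charFun_apply, charFun_stdComplexGaussian, norm_mul, RCLike.norm_conj]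
    congr 3
    ring
  simp_rw [h1]
  rw [← Complex.exp_sum, charFun_stdComplexGaussian]
  congr 1
  rw [Finset.sum_neg_distrib, ← Complex.ofReal_sum]
  congr 2
  rw [← Finset.sum_div, ← Finset.sum_mul, hv, one_mul]

lemma memLp_dual {E : Type*} [NormedAddCommGroup E] [NormedSpace ℝ E]
    [CompleteSpace E] [MeasurableSpace E] [BorelSpace E] [SecondCountableTopology E]
    {F : Type*} [NormedAddCommGroup F] [NormedSpace ℝ F]
    (μ : Measure E) [IsGaussian μ] (L : E →L[ℝ] F) : MemLp (fun x => L x) 2 μ := 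
  L.comp_memLp' (IsGaussian.memLp_two_id (μ := μ))

lemma integral_id_stdComplexGaussian : ∫ z, z ∂stdComplexGaussian = 0 := by
  have hint : Integrable (fun z : ℂ => z) stdComplexGaussian :=
    IsGaussian.integrable_id (μ := stdComplexGaussian)
  have h : stdComplexGaussian = ((gaussianReal 0 (1 / 2)).prod (gaussianReal 0 (1 / 2))).map
      Complex.measurableEquivRealProd.symm := rfl
  apply Complex.ext
  · rw [← RCLike.re_eq_complex_re, ← integral_re hint, h, integral_map_equiv]
    have := integral_fun_fst (μ := gaussianReal 0 (1/2)) (ν := gaussianReal 0 (1 / 2))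
      (f := fun x : ℝ => x)
    simpa [Complex.measurableEquivRealProd, Complex.equivRealProd] using this
  · rw [← RCLike.im_eq_complex_im, ← integral_im hint, h, integral_map_equiv]
    have := integral_fun_snd (μ := gaussianReal 0 (1/2)) (ν := gaussianReal 0 (1 / 2))
      (f := fun x : ℝ => x)
    simpa [Complex.measurableEquivRealProd, Complex.equivRealProd] using this

lemma integrable_sq_stdComplexGaussian :
    Integrable (fun z : ℂ => ‖z‖ ^ 2) stdComplexGaussian :=
  (IsGaussian.memLp_two_id (μ := stdComplexGaussian)).integrable_norm_pow (by norm_num)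

lemma integral_sq_stdComplexGaussian : ∫ z, ‖z‖ ^ 2 ∂stdComplexGaussian = 1 := by
  have h : stdComplexGaussian = ((gaussianReal 0 (1 / 2)).prod (gaussianReal 0 (1 / 2))).map
      Complex.measurableEquivRealProd.symm := rfl
  have hr : ∫ x, x ^ 2 ∂(gaussianReal 0 (1 / 2)) = 1 / 2 := by
    have := variance_fun_id_gaussianReal (μ := 0) (v := 1 / 2)
    rw [variance_of_integral_eq_zero (by fun_prop) (by simp)] at this
    simpa using this
  have hi : Integrable (fun x : ℝ => x ^ 2) (gaussianReal 0 (1 / 2)) :=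
    (memLp_id_gaussianReal (μ := 0) (v := 1 / 2) 2).integrable_sq
  rw [h, integral_map_equiv]
  have h2 : ∀ x : ℝ × ℝ, ‖Complex.measurableEquivRealProd.symm x‖ ^ 2 = x.1 ^ 2 + x.2 ^ 2 := by
    intro x
    rw [← Complex.normSq_eq_norm_sq, Complex.normSq_apply]
    simp [Complex.measurableEquivRealProd]
    ring
  simp_rw [h2]
  rw [integral_add (hi.comp_fst _) (hi.comp_snd _)]
  have h3 := integral_fun_fst (μ := gaussianReal 0 (1/2)) (ν := gaussianReal 0 (1 / 2))
      (f := fun x : ℝ => x ^ 2)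
  have h4 := integral_fun_snd (μ := gaussianReal 0 (1/2)) (ν := gaussianReal 0 (1 / 2))
      (f := fun x : ℝ => x ^ 2)
  rw [h3, h4, hr]
  norm_num

lemma integral_id_gaussianArray (M : ℕ) : ∫ H, H ∂(gaussianArray M) = 0 := by
  have hint : Integrable (fun H => H) (gaussianArray M) :=
    IsGaussian.integrable_id (μ := gaussianArray M)
  ext k a
  rw [eval_integral (fun i => hint.eval i), eval_integral (fun i => (hint.eval k).eval i),
    gaussianArray, integral_comp_eval (μ := fun _ : Fin M => Measure.pi fun _ : Fin M =>
      stdComplexGaussian) (i := k) (f := fun h => h a) (measurable_pi_apply a).aestronglyMeasurable,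
    integral_comp_eval (μ := fun _ : Fin M => stdComplexGaussian) (i := a) (f := fun h => h)
      aestronglyMeasurable_id, integral_id_stdComplexGaussian]
  rfl

/-! ### Linear Gaussian estimation -/

section LinearGaussianModel

variable {E : Type*} [NormedAddCommGroup E] [NormedSpace ℝ E] [MeasurableSpace E]

/-- `β` noisy observations of the signal `ω.1`, scaled by `s`. -/
noncomputable def obs (s : ℝ) (β : ℕ) (ω : E × (Fin β → E)) (b : Fin β) : E := s • ω.1 + ω.2 b

/-- The linear MMSE estimate of a signal from observations `y` with gain `s`, if signal and noise
have the same covariance. -/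
noncomputable def lmmse (s : ℝ) {β : ℕ} (y : Fin β → E) : E := (s / (1 + β * s ^ 2)) • ∑ b, y b

/-- The error of the linear MMSE estimate. -/
noncomputable def estErr (s : ℝ) (β : ℕ) (ω : E × (Fin β → E)) : E := ω.1 - lmmse s (obs s β ω)

variable (μ : Measure E) [IsGaussian μ] (s : ℝ) (β : ℕ)

/-- The joint law of the signal and of the noise. -/
noncomputable abbrev signalNoiseLaw : Measure (E × (Fin β → E)) := μ.prod (Measure.pi fun _ => μ)

lemma measurePreserving_noise (b : Fin β) :
    MeasurePreserving (fun ω : E × (Fin β → E) => ω.2 b) (signalNoiseLaw μ β) μ :=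
  (measurePreserving_eval (fun _ : Fin β => μ) b).comp measurePreserving_snd

variable [BorelSpace E] [SecondCountableTopology E]

@[fun_prop]
lemma measurable_obs (s : ℝ) (β : ℕ) : Measurable (obs (E := E) s β) := by
  unfold obs; fun_prop

@[fun_prop]
lemma measurable_lmmse (s : ℝ) (β : ℕ) : Measurable (lmmse (E := E) s (β := β)) := by
  unfold lmmse; fun_prop

@[fun_prop]
lemma measurable_estErr (s : ℝ) (β : ℕ) : Measurable (estErr (E := E) s β) := by
  unfold estErr; fun_prop

lemma covariance_signal_signal (L L' : StrongDual ℝ E) :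
    cov[fun ω : E × (Fin β → E) => L ω.1, fun ω => L' ω.1; signalNoiseLaw μ β] = cov[L, L'; μ] := by
  have h := (measurePreserving_fst (μ := μ) (ν := Measure.pi fun _ : Fin β => μ))
  conv_rhs => rw [← h.map_eq]
  rw [covariance_map (by fun_prop) (by fun_prop) (by fun_prop)]
  rfl

variable [CompleteSpace E]

/-- Both components are continuous linear in signal and noise. Joint Gaussianity is what later turns
vanishing covariance into independence. -/
lemma hasGaussianLaw_estErr_obs :
    HasGaussianLaw (fun ω => (estErr s β ω, obs s β ω)) (signalNoiseLaw μ β) := by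
  let A : E × (Fin β → E) →L[ℝ] E := ContinuousLinearMap.fst ℝ E (Fin β → E)
  let B : E × (Fin β → E) →L[ℝ] (Fin β → E) := ContinuousLinearMap.pi fun b =>
    s • A + (ContinuousLinearMap.proj b).comp (ContinuousLinearMap.snd ℝ E (Fin β → E))
  let C : E × (Fin β → E) →L[ℝ] E := A - (s / (1 + β * s ^ 2)) • ∑ b : Fin β,
    (s • A + (ContinuousLinearMap.proj b).comp (ContinuousLinearMap.snd ℝ E (Fin β → E)))
  have h := (IsGaussian.hasGaussianLaw_id (μ := signalNoiseLaw μ β)).map_fun (C.prod B)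
  have h2 : (fun ω => (C.prod B) (id ω)) = fun ω => (estErr s β ω, obs s β ω) := by
    ext ω : 1
    refine Prod.ext ?_ ?_
    · simp [C, A, estErr, lmmse, obs]
    · ext b
      simp [B, A, obs]
  rwa [h2] at h

lemma memLp_signal (L : StrongDual ℝ E) :
    MemLp (fun ω : E × (Fin β → E) => L ω.1) 2 (signalNoiseLaw μ β) :=
  (memLp_dual μ L).comp_measurePreserving measurePreserving_fst

lemma memLp_noise (L : StrongDual ℝ E) (b : Fin β) :
    MemLp (fun ω : E × (Fin β → E) => L (ω.2 b)) 2 (signalNoiseLaw μ β) :=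
  (memLp_dual μ L).comp_measurePreserving (measurePreserving_noise μ β b)

lemma memLp_obs (L : StrongDual ℝ E) (b : Fin β) :
    MemLp (fun ω : E × (Fin β → E) => L (obs s β ω b)) 2 (signalNoiseLaw μ β) := by
  simp only [obs, map_add, map_smul]
  exact ((memLp_signal μ β L).const_smul s).add (memLp_noise μ β L b)

lemma covariance_signal_noise (L L' : StrongDual ℝ E) (b : Fin β) :
    cov[fun ω : E × (Fin β → E) => L ω.1, fun ω => L' (ω.2 b); signalNoiseLaw μ β] = 0 := by
  have h : IndepFun (fun ω : E × (Fin β → E) => L ω.1) (fun ω => L' (ω.2 b))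
      (signalNoiseLaw μ β) :=
    indepFun_prod (X := fun x : E => L x) (Y := fun y : Fin β → E => L' (y b))
      (by fun_prop) (by fun_prop)
  exact h.covariance_eq_zero (memLp_signal μ β L) (memLp_noise μ β L' b)

lemma covariance_noise_noise (L L' : StrongDual ℝ E) (b b' : Fin β) :
    cov[fun ω : E × (Fin β → E) => L (ω.2 b), fun ω => L' (ω.2 b'); signalNoiseLaw μ β] =
      if b = b' then cov[L, L'; μ] else 0 := by
  split_ifs with hb
  · subst hb
    have h := measurePreserving_noise μ β b
    conv_rhs => rw [← h.map_eq]
    rw [covariance_map (by fun_prop) (by fun_prop) (by fun_prop)]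
    rfl
  · have h1 : iIndepFun (fun (b : Fin β) (ω : Fin β → E) => ω b) (Measure.pi fun _ => μ) :=
      iIndepFun_pi (μ := fun _ : Fin β => μ) (X := fun (_ : Fin β) (x : E) => x)
        (fun i => measurable_id.aemeasurable)
    have h2 : IndepFun (fun ω : Fin β → E => L (ω b)) (fun ω : Fin β → E => L' (ω b'))
        (Measure.pi fun _ : Fin β => μ) :=
      (h1.indepFun hb).comp (φ := L) (ψ := L') (by fun_prop) (by fun_prop)
    have h3 := (measurePreserving_snd (μ := μ) (ν := Measure.pi fun _ : Fin β => μ))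
    have h4 := h2.covariance_eq_zero
      ((memLp_dual μ L).comp_measurePreserving (measurePreserving_eval (fun _ : Fin β => μ) b))
      ((memLp_dual μ L').comp_measurePreserving (measurePreserving_eval (fun _ : Fin β => μ) b'))
    rw [← h3.map_eq, covariance_map
      (by fun_prop : Measurable fun ω : Fin β → E => L (ω b)).aestronglyMeasurable
      (by fun_prop : Measurable fun ω : Fin β → E => L' (ω b')).aestronglyMeasurable
      (by fun_prop)] at h4
    exact h4

lemma covariance_signal_obs (L L' : StrongDual ℝ E) (b : Fin β) :
    cov[fun ω : E × (Fin β → E) => L ω.1, fun ω => L' (obs s β ω b); signalNoiseLaw μ β] =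
      s * cov[L, L'; μ] := by
  simp only [obs, map_add, map_smul, smul_eq_mul]
  have := covariance_add_right (memLp_signal μ β L) ((memLp_signal μ β L').const_smul s)
    (memLp_noise μ β L' b)
  rw [covariance_smul_right, covariance_signal_signal, covariance_signal_noise, add_zero] at this
  exact this

lemma covariance_obs_obs (L L' : StrongDual ℝ E) (b b' : Fin β) :
    cov[fun ω : E × (Fin β → E) => L (obs s β ω b), fun ω => L' (obs s β ω b');
      signalNoiseLaw μ β] =
      s ^ 2 * cov[L, L'; μ] + if b = b' then cov[L, L'; μ] else 0 := by
  have h1 := covariance_add_left ((memLp_signal μ β L).const_smul s) (memLp_noise μ β L b)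
    (memLp_obs μ s β L' b')
  have h2 := covariance_add_right (memLp_noise μ β L b) ((memLp_signal μ β L').const_smul s)
    (memLp_noise μ β L' b')
  rw [covariance_smul_right, covariance_noise_noise,
    covariance_comm _ (fun ω : E × (Fin β → E) => L' ω.1), covariance_signal_noise,
    mul_zero, zero_add] at h2
  rw [covariance_smul_left, covariance_signal_obs] at h1
  simp only [obs, map_add, map_smul, smul_eq_mul] at h1 ⊢
  refine h1.trans ?_
  rw [← mul_assoc, ← pow_two]
  exact congrArg _ h2

lemma covariance_estErr_left (L : StrongDual ℝ E) {Y : E × (Fin β → E) → ℝ}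
    (hY : MemLp Y 2 (signalNoiseLaw μ β)) :
    cov[fun ω => L (estErr s β ω), Y; signalNoiseLaw μ β] =
      cov[fun ω : E × (Fin β → E) => L ω.1, Y; signalNoiseLaw μ β] -
        s / (1 + β * s ^ 2) * ∑ b, cov[fun ω => L (obs s β ω b), Y; signalNoiseLaw μ β] := by
  have h1 : MemLp (fun ω : E × (Fin β → E) => ∑ b, L (obs s β ω b)) 2 (signalNoiseLaw μ β) :=
    memLp_finsetSum _ fun b _ => memLp_obs μ s β L b
  have h := covariance_fun_sub_left (memLp_signal μ β L) (h1.const_mul (s / (1 + β * s ^ 2))) hY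
  rw [covariance_const_mul_left, covariance_fun_sum_left (fun b => memLp_obs μ s β L b) hY] at h
  rw [← h]
  simp [estErr, lmmse]

/-- For a jointly Gaussian pair zero covariance suffices. If `C` is the common covariance of signal
and noise, one observation has covariance `s C` with the signal and `(1 + β s²) C` with the sum of
all observations. The weight `s / (1 + β s²)` is the one that cancels them. -/
lemma indepFun_estErr_obs :
    IndepFun (estErr s β) (obs s β) (signalNoiseLaw μ β) := by
  refine (hasGaussianLaw_estErr_obs μ s β).indepFun_of_covariance_strongDual fun L₁ L₂ => ?_
  have hL₂ : L₂ ∘ obs s β = fun ω => ∑ b, (L₂ ∘L ContinuousLinearMap.single ℝ (fun _ => E) b)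
      (obs s β ω b) := by
    ext ω
    simp only [Function.comp_apply, ContinuousLinearMap.comp_apply]
    rw [← map_sum]
    congr 1
    simp [Finset.univ_sum_single]
  rw [hL₂]
  change cov[fun ω => L₁ (estErr s β ω), _; _] = 0
  rw [covariance_estErr_left μ s β L₁ (memLp_finsetSum _ fun b _ => memLp_obs μ s β _ b)]
  simp_rw [covariance_fun_sum_right (fun b => memLp_obs μ s β _ b) (memLp_obs μ s β L₁ _),
    covariance_fun_sum_right (fun b => memLp_obs μ s β _ b) (memLp_signal μ β L₁),
    covariance_signal_obs, covariance_obs_obs]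
  rw [Finset.sum_comm]
  simp only [Finset.sum_add_distrib, Finset.sum_const, Finset.card_univ, Fintype.card_fin,
    Finset.sum_ite_eq', Finset.mem_univ, if_true, nsmul_eq_mul,
    ← Finset.mul_sum]
  have : (1 + β * s ^ 2 : ℝ) ≠ 0 := by positivity
  field_simp
  ring

lemma memLp_estErr (L : StrongDual ℝ E) :
    MemLp (fun ω => L (estErr s β ω)) 2 (signalNoiseLaw μ β) :=
  ((hasGaussianLaw_estErr_obs μ s β).fst.map_fun L).memLp_two

/-- The error is uncorrelated with the observations, so its variance is its covariance with the
signal, the fraction `1 - β s² / (1 + β s²)` of the signal variance. -/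
lemma variance_estErr (L : StrongDual ℝ E) :
    Var[fun ω => L (estErr s β ω); signalNoiseLaw μ β] = Var[L; μ] / (1 + β * s ^ 2) := by
  have h0 : ∀ b, cov[fun ω => L (obs s β ω b), fun ω => L (estErr s β ω);
      signalNoiseLaw μ β] = 0 := by
    intro b
    have h : IndepFun (fun ω => L (obs s β ω b)) (fun ω => L (estErr s β ω))
        (signalNoiseLaw μ β) :=
      (indepFun_estErr_obs μ s β).symm.comp (φ := fun y : Fin β → E => L (y b))
        (ψ := fun x => L x)
        (by fun_prop) (by fun_prop)
    exact h.covariance_eq_zero (memLp_obs μ s β L b) (memLp_estErr μ s β L)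
  rw [← covariance_self (by fun_prop), covariance_estErr_left μ s β L (memLp_estErr μ s β L)]
  simp_rw [h0]
  rw [covariance_comm, covariance_estErr_left μ s β L (memLp_signal μ β L)]
  simp_rw [covariance_comm (fun ω => L (obs s β ω _)), covariance_signal_obs,
    covariance_signal_signal]
  rw [covariance_self (by fun_prop)]
  have : (1 + β * s ^ 2 : ℝ) ≠ 0 := by positivity
  simp
  field_simp
  ring

variable {μ} in
lemma integral_estErr (hμ : ∫ x, x ∂μ = 0) : ∫ ω, estErr s β ω ∂(signalNoiseLaw μ β) = 0 := by
  have h1 : Integrable (fun ω : E × (Fin β → E) => ω.1) (signalNoiseLaw μ β) :=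
    (IsGaussian.integrable_id (μ := μ)).comp_fst _
  have h2 : ∀ b, Integrable (fun ω : E × (Fin β → E) => ω.2 b) (signalNoiseLaw μ β) := fun b =>
    (measurePreserving_noise μ β b).integrable_comp_of_integrable
      (IsGaussian.integrable_id (μ := μ))
  have h3 : ∫ ω : E × (Fin β → E), ω.1 ∂(signalNoiseLaw μ β) = 0 := by
    rw [integral_fun_fst (f := fun x : E => x), hμ, smul_zero]
  have h4 : ∀ b, ∫ ω : E × (Fin β → E), ω.2 b ∂(signalNoiseLaw μ β) = 0 := fun b => by
    have := (measurePreserving_noise μ β b)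
    rw [← integral_map (f := fun x : E => x) (by fun_prop) (by fun_prop), this.map_eq, hμ]
  have h5 : ∀ b, Integrable (fun ω : E × (Fin β → E) => obs s β ω b) (signalNoiseLaw μ β) :=
    fun b => (h1.smul s).add (h2 b)
  have h6 : ∀ b, ∫ ω, obs s β ω b ∂(signalNoiseLaw μ β) = 0 := fun b => by
    unfold obs
    have h7 : Integrable (fun ω : E × (Fin β → E) => s • ω.1) (signalNoiseLaw μ β) := h1.smul s
    rw [integral_add h7 (h2 b), integral_smul, h3, h4, smul_zero, add_zero]
  unfold estErr lmmse
  have h8 : Integrable (fun ω : E × (Fin β → E) => (s / (1 + β * s ^ 2)) • ∑ b, obs s β ω b)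
      (signalNoiseLaw μ β) := (integrable_finsetSum _ fun b _ => h5 b).smul _
  rw [integral_sub h1 h8, integral_smul, integral_finsetSum _ fun b _ => h5 b, h3]
  simp [h6]

end LinearGaussianModel

/-! ### The MMSE estimate as a conditional mean -/

lemma pilots_eq_obs (M β : ℕ) (P f : ℝ) : pilots M β P f = obs (Real.sqrt (f * P)) β := by
  ext ω b k a
  simp [pilots, obs]

/-- If `X` is centered and independent of `Z`, then the conditional mean of `X + g(Z)` given `Z`
is `g(Z)`. -/
lemma condExp_add_comp_of_indepFun {Ω F : Type*} [MeasurableSpace Ω] [MeasurableSpace F]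
    {μ : Measure Ω} [IsProbabilityMeasure μ] {X : Ω → ℂ} {Z : Ω → F} {g : F → ℂ}
    (hXm : Measurable X) (hZ : Measurable Z) (hg : Measurable g) (hX : Integrable X μ)
    (hgZ : Integrable (fun ω => g (Z ω)) μ) (hXZ : IndepFun X Z μ) (h0 : ∫ ω, X ω ∂μ = 0) :
    μ[fun ω => X ω + g (Z ω) | MeasurableSpace.comap Z inferInstance] =ᵐ[μ]
      fun ω => g (Z ω) := by
  have h1 : μ[X | MeasurableSpace.comap Z inferInstance] =ᵐ[μ] fun _ => 0 := by
    rw [← h0]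
    exact condExp_indep_eq hXm.comap_le hZ.comap_le
      (comap_measurable X).stronglyMeasurable hXZ
  have h2 := condExp_of_stronglyMeasurable (μ := μ) hZ.comap_le
    (hg.comp (comap_measurable Z)).stronglyMeasurable hgZ
  have h3 := condExp_add hX hgZ (MeasurableSpace.comap Z inferInstance)
  filter_upwards [h1, h3] with ω h1 h3
  refine h3.trans ?_
  rw [Pi.add_apply, h1, zero_add]
  exact congrFun h2 ω

/-- The channel is a centered error plus a function of the pilots independent of that error, so
conditioning leaves only the function. -/
lemma mmseEstimate_ae_eq (M β : ℕ) (P f : ℝ) :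
    ∀ᵐ ω ∂(blockLaw M β), mmseEstimate M β P f ω =
      Matrix.of (lmmse (Real.sqrt (f * P)) (obs (Real.sqrt (f * P)) β ω)) := by
  set s := Real.sqrt (f * P)
  have key : ∀ k a, ∀ᵐ ω ∂(blockLaw M β), mmseEstimate M β P f ω k a =
      lmmse s (obs s β ω) k a := by
    intro k a
    have hiH : Integrable (fun ω : Block M β => ω.1) (blockLaw M β) :=
      (IsGaussian.integrable_id (μ := gaussianArray M)).comp_fst _
    have hiE : Integrable (estErr s β) (blockLaw M β) :=
      (hasGaussianLaw_estErr_obs (gaussianArray M) s β).fst.integrable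
    have hiL : Integrable (fun ω : Block M β => lmmse s (obs s β ω)) (blockLaw M β) := by
      have h := hiH.sub hiE
      refine h.congr (Filter.Eventually.of_forall fun ω => ?_)
      simp [estErr]
    have h2 : IndepFun (fun ω : Block M β => estErr s β ω k a) (obs s β) (blockLaw M β) :=
      (indepFun_estErr_obs (gaussianArray M) s β).comp
        (φ := fun x : Fin M → Fin M → ℂ => x k a) (ψ := fun y => y) (by fun_prop) (by fun_prop)
    have h3 : ∫ ω : Block M β, estErr s β ω k a ∂(blockLaw M β) = 0 := by
      rw [← eval_integral (fun i => (hiE.eval k).eval i), ← eval_integral (fun i => hiE.eval i)]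
      have := integral_estErr s β (integral_id_gaussianArray M)
      exact congrFun (congrFun this k) a
    have h4 := condExp_add_comp_of_indepFun (g := fun y : Fin β → Fin M → Fin M → ℂ => lmmse s y k a)
      (by fun_prop) (measurable_obs s β) (by fun_prop) ((hiE.eval k).eval a)
      ((hiL.eval k).eval a) h2 h3
    have h7 : (fun ω : Block M β => ω.1 k a) =
        fun ω : Block M β => estErr s β ω k a + lmmse s (obs s β ω) k a := by
      ext ω
      simp [estErr]
    simp only [mmseEstimate, Matrix.of_apply, pilots_eq_obs]
    rw [h7]
    exact h4
  have := ae_all_iff.2 fun k => ae_all_iff.2 fun a => key k a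
  filter_upwards [this] with ω hω
  ext k a
  exact hω k a

/-! ### Almost sure invertibility -/

section AbsolutelyContinuous

lemma absolutelyContinuous_pi_fin {α : Type*} [MeasurableSpace α] {μ ν : Measure α}
    [SigmaFinite μ] [SigmaFinite ν] (h : μ ≪ ν) (n : ℕ) :
    Measure.pi (fun _ : Fin n => μ) ≪ Measure.pi (fun _ : Fin n => ν) := by
  induction n with
  | zero =>
    rw [Measure.pi_of_empty, Measure.pi_of_empty]
  | succ n ih =>
    rw [← (measurePreserving_piFinSuccAbove (fun _ : Fin (n + 1) => μ) 0).symm.map_eq,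
      ← (measurePreserving_piFinSuccAbove (fun _ : Fin (n + 1) => ν) 0).symm.map_eq]
    exact (h.prod ih).map (MeasurableEquiv.measurable _)

lemma stdComplexGaussian_absolutelyContinuous : stdComplexGaussian ≪ volume := by
  have h : stdComplexGaussian = ((gaussianReal 0 (1 / 2)).prod (gaussianReal 0 (1 / 2))).map
      Complex.measurableEquivRealProd.symm := rfl
  have h2 := Complex.volume_preserving_equiv_real_prod.symm.map_eq
  rw [h, ← h2]
  refine Measure.AbsolutelyContinuous.map ?_ (MeasurableEquiv.measurable _)
  exact (gaussianReal_absolutelyContinuous _ (by norm_num)).prod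
    (gaussianReal_absolutelyContinuous _ (by norm_num))

lemma gaussianArray_absolutelyContinuous (M : ℕ) : gaussianArray M ≪ volume :=
  absolutelyContinuous_pi_fin (absolutelyContinuous_pi_fin stdComplexGaussian_absolutelyContinuous M) M

-- As a polynomial in `t` the determinant is the characteristic polynomial of `-A`, which is monic
-- and so has finitely many roots.
open Polynomial in
lemma finite_setOf_det_add_smul_one_eq_zero {n : Type*} [Fintype n] [DecidableEq n]
    (A : Matrix n n ℂ) : {t : ℂ | (A + t • 1).det = 0}.Finite := by
  have h : (Matrix.charpoly (-A)) ≠ 0 := (Matrix.charpoly_monic _).ne_zero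
  refine (Polynomial.finite_setOfPred_isRoot h).subset fun t ht => ?_
  simp only [Set.mem_ofPred_eq, Polynomial.IsRoot.def, Matrix.eval_charpoly] at ht ⊢
  rw [← ht]
  congr 1
  rw [sub_neg_eq_add, add_comm, Matrix.smul_one_eq_diagonal]
  rfl

lemma measurable_det {M : ℕ} :
    Measurable fun H : Fin M → Fin M → ℂ => (Matrix.of H).det := by
  have : Continuous fun H : Fin M → Fin M → ℂ => (Matrix.of H).det :=
    Continuous.matrix_det (continuous_id)
  exact this.measurable

/-- A matrix is almost surely regular, with respect to Lebesgue measure: a singular one becomes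
regular under all but finitely many shifts along the identity. -/
lemma volume_setOf_det_eq_zero (M : ℕ) :
    volume {H : Fin M → Fin M → ℂ | (Matrix.of H).det = 0} = 0 := by
  set Z : Set (Fin M → Fin M → ℂ) := {H | (Matrix.of H).det = 0} with hZ
  have hZm : MeasurableSet Z := measurable_det (measurableSet_singleton 0)
  let J : ℂ → Fin M → Fin M → ℂ := fun t => fun k a => (t • (1 : Matrix (Fin M) (Fin M) ℂ)) k a
  have hJ : Measurable J := by
    refine measurable_pi_lambda _ fun k => measurable_pi_lambda _ fun a => ?_
    simp only [J, Matrix.smul_apply, smul_eq_mul]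
    fun_prop
  have hS : MeasurableSet {p : (Fin M → Fin M → ℂ) × ℂ | p.1 + J p.2 ∈ Z} :=
    (measurable_fst.add (hJ.comp measurable_snd)) hZm
  -- Fubini in two directions: for fixed `H` the bad shifts are finitely many, hence null; for fixed
  -- `t` the section is a translate of `Z`. So `volume Z` times the infinite volume of `ℂ` is zero.
  have h1 : ((volume : Measure (Fin M → Fin M → ℂ)).prod (volume : Measure ℂ))
      {p : (Fin M → Fin M → ℂ) × ℂ | p.1 + J p.2 ∈ Z} = 0 := by
    rw [Measure.measure_prod_null hS]
    refine Filter.Eventually.of_forall fun H => ?_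
    exact (finite_setOf_det_add_smul_one_eq_zero (Matrix.of H)).measure_zero _
  have h2 : ∀ t : ℂ, volume ((fun H => (H, t)) ⁻¹' {p : (Fin M → Fin M → ℂ) × ℂ |
      p.1 + J p.2 ∈ Z}) = volume Z := fun t =>
    measure_preimage_add_right volume (J t) Z
  rw [Measure.prod_apply_symm hS] at h1
  simp_rw [h2] at h1
  simpa using h1

/-- With the noise frozen, the channel estimate has this affine form in `H`; such a map with `c ≠ 0`
pulls null sets back to null sets. -/
lemma ae_det_smul_add_ne_zero {M : ℕ} {c : ℝ} (hc : c ≠ 0) (B : Fin M → Fin M → ℂ) :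
    ∀ᵐ H ∂(gaussianArray M), (Matrix.of (c • H + B)).det ≠ 0 := by
  refine (gaussianArray_absolutelyContinuous M).ae_le ?_
  have h1 : ∀ᵐ H : Fin M → Fin M → ℂ, (Matrix.of H).det ≠ 0 := by
    rw [ae_iff]
    simpa using volume_setOf_det_eq_zero M
  have h2 : Measure.QuasiMeasurePreserving (fun H : Fin M → Fin M → ℂ => c • H + B)
      volume volume := by
    refine (measurePreserving_add_right volume B).quasiMeasurePreserving.comp
      ⟨by fun_prop, ?_⟩
    have h3 : (volume : Measure (Fin M → ℂ)).IsAddHaarMeasure := Measure.pi.isAddHaarMeasure _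
    have h4 : (volume : Measure (Fin M → Fin M → ℂ)).IsAddHaarMeasure :=
      Measure.pi.isAddHaarMeasure _
    rw [Measure.map_addHaar_smul volume hc]
    exact Measure.smul_absolutelyContinuous
  exact h2.ae h1

end AbsolutelyContinuous

/-! ### Zero-forcing beams -/

section Beams

variable {M : ℕ}

lemma sum_norm_sq_zfBeam (G : Matrix (Fin M) (Fin M) ℂ) (j : Fin M) :
    ∑ a, ‖zfBeam G j a‖ ^ 2 = 1 := by
  rw [← EuclideanSpace.norm_sq_eq]
  unfold zfBeam
  split_ifs with h
  · have hne : (WithLp.toLp 2 (fun a => G⁻¹ a j) : EuclideanSpace ℂ (Fin M)) ≠ 0 := by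
      intro h0
      have h1 : ∀ a, G⁻¹ a j = 0 := fun a => congrArg (fun v : EuclideanSpace ℂ (Fin M) => v a) h0
      have h2 := congrFun (congrFun (Matrix.mul_nonsing_inv G h) j) j
      simp [Matrix.mul_apply, h1] at h2
    rw [norm_smul]
    simp [hne]
  · simp

lemma sum_mul_zfBeam_of_ne {G : Matrix (Fin M) (Fin M) ℂ} (hG : G.det ≠ 0) {k j : Fin M}
    (hkj : k ≠ j) : ∑ a, G k a * zfBeam G j a = 0 := by
  have h : IsUnit G.det := isUnit_iff_ne_zero.2 hG
  have h2 := congrFun (congrFun (Matrix.mul_nonsing_inv G h) k) j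
  rw [Matrix.mul_apply, Matrix.one_apply_ne hkj] at h2
  unfold zfBeam
  rw [if_pos h]
  simp only [PiLp.smul_apply, smul_eq_mul]
  simp_rw [mul_left_comm (G k _)]
  rw [← Finset.mul_sum, h2, mul_zero]

/-- The normalized `k`-th column of the adjugate of `G`; it does not depend on row `k`. -/
noncomputable def adjBeam (G : Matrix (Fin M) (Fin M) ℂ) (k : Fin M) :
    EuclideanSpace ℂ (Fin M) :=
  open Classical in
  if (WithLp.toLp 2 fun a => G.adjugate a k : EuclideanSpace ℂ (Fin M)) = 0 then
    EuclideanSpace.single k 1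
  else ((‖(WithLp.toLp 2 fun a => G.adjugate a k : EuclideanSpace ℂ (Fin M))‖⁻¹ : ℝ) : ℂ) •
    WithLp.toLp 2 fun a => G.adjugate a k

lemma sum_norm_sq_adjBeam (G : Matrix (Fin M) (Fin M) ℂ) (k : Fin M) :
    ∑ a, ‖adjBeam G k a‖ ^ 2 = 1 := by
  rw [← EuclideanSpace.norm_sq_eq]
  unfold adjBeam
  split_ifs with h
  · simp
  · rw [norm_smul]
    simp [h]

/-- Column `k` of the adjugate consists of determinants in which row `k` has been overwritten. This
makes a user's beam independent of that user's own channel. -/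
lemma adjBeam_updateRow (G : Matrix (Fin M) (Fin M) ℂ) (k : Fin M) (x : Fin M → ℂ) :
    adjBeam (G.updateRow k x) k = adjBeam G k := by
  have h : ∀ a, (G.updateRow k x).adjugate a k = G.adjugate a k := by
    intro a
    rw [Matrix.adjugate_apply, Matrix.adjugate_apply]
    congr 1
    ext i b
    by_cases hi : i = k <;> simp [hi, Matrix.updateRow_apply]
  unfold adjBeam
  simp_rw [h]

/-- The inverse is the adjugate divided by the determinant, so after normalization the two beams
differ by a phase, invisible to the gain. -/
lemma norm_sum_mul_zfBeam {G : Matrix (Fin M) (Fin M) ℂ} (hG : G.det ≠ 0) (k : Fin M)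
    (h : Fin M → ℂ) :
    ‖∑ a, h a * zfBeam G k a‖ = ‖∑ a, h a * adjBeam G k a‖ := by
  have hu : IsUnit G.det := isUnit_iff_ne_zero.2 hG
  set c : EuclideanSpace ℂ (Fin M) := WithLp.toLp 2 fun a => G.adjugate a k with hc
  have h1 : (WithLp.toLp 2 fun a => G⁻¹ a k : EuclideanSpace ℂ (Fin M)) = (G.det)⁻¹ • c := by
    ext a
    simp [Matrix.inv_def, hc]
  have hne : c ≠ 0 := by
    intro h0
    have h2 := sum_norm_sq_zfBeam G k
    rw [← EuclideanSpace.norm_sq_eq, zfBeam, if_pos hu, h1, h0] at h2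
    simp at h2
  have h3 : zfBeam G k = (((‖(G.det)⁻¹‖⁻¹ : ℝ) : ℂ) * (G.det)⁻¹) • adjBeam G k := by
    rw [zfBeam, if_pos hu, adjBeam, if_neg hne, h1, ← hc, norm_smul, smul_smul, smul_smul]
    congr 1
    push_cast
    rw [mul_inv]
    ring
  rw [h3]
  simp only [PiLp.smul_apply, smul_eq_mul]
  simp_rw [mul_left_comm (h _)]
  rw [← Finset.mul_sum, norm_mul]
  simp [hG]

@[fun_prop]
lemma measurable_adjugate (a k : Fin M) :
    Measurable fun G : Fin M → Fin M → ℂ => (Matrix.of G).adjugate a k := by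
  have h : Continuous fun G : Fin M → Fin M → ℂ => (Matrix.of G).adjugate :=
    Continuous.matrix_adjugate continuous_id
  exact (h.matrix_elem a k).measurable

@[fun_prop]
lemma measurable_zfBeam (j : Fin M) :
    Measurable fun G : Fin M → Fin M → ℂ => zfBeam (Matrix.of G) j := by
  have h0 : Measurable fun G : Fin M → Fin M → ℂ =>
      (WithLp.toLp 2 fun a => (Matrix.of G)⁻¹ a j : EuclideanSpace ℂ (Fin M)) := by
    refine (WithLp.measurable_toLp 2 _).comp (measurable_pi_lambda _ fun a => ?_)
    simp only [Matrix.inv_def, Matrix.smul_apply, Ring.inverse_eq_inv', smul_eq_mul]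
    exact measurable_det.inv.mul (measurable_adjugate a j)
  unfold zfBeam
  refine Measurable.ite ?_ ?_ measurable_const
  · simp only [isUnit_iff_ne_zero]
    exact (measurable_det (measurableSet_singleton 0)).compl
  · exact (Complex.measurable_ofReal.comp h0.norm.inv).smul h0

@[fun_prop]
lemma measurable_adjBeam (j : Fin M) :
    Measurable fun G : Fin M → Fin M → ℂ => adjBeam (Matrix.of G) j := by
  have h0 : Measurable fun G : Fin M → Fin M → ℂ =>
      (WithLp.toLp 2 fun a => (Matrix.of G).adjugate a j : EuclideanSpace ℂ (Fin M)) :=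
    (WithLp.measurable_toLp 2 _).comp (measurable_pi_lambda _ fun a => measurable_adjugate a j)
  unfold adjBeam
  refine Measurable.ite ?_ measurable_const ?_
  · exact h0 (measurableSet_singleton 0)
  · exact (Complex.measurable_ofReal.comp h0.norm.inv).smul h0

/-- A row of i.i.d. `CN(0,1)` entries, combined with weights that have unit norm and depend on the
other rows only, is `CN(0,1)`. -/
lemma map_row_comb_gaussianArray (k : Fin M)
    {u : (Fin M → Fin M → ℂ) → EuclideanSpace ℂ (Fin M)} (hu : Measurable u)
    (hu1 : ∀ H, ∑ a, ‖u H a‖ ^ 2 = 1) (huk : ∀ H x, u (Function.update H k x) = u H) :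
    (gaussianArray M).map (fun H => ∑ a, H k a * u H a) = stdComplexGaussian := by
  have hua : ∀ a, Measurable fun H => u H a := fun a => by fun_prop
  have hm : Measurable fun H : Fin M → Fin M → ℂ => ∑ a, H k a * u H a :=
    Finset.measurable_sum _ fun a _ => by fun_prop
  refine Measure.ext_of_lintegral _ fun f hf => ?_
  rw [lintegral_map hf hm]
  have hc : ∫⁻ z, f z ∂stdComplexGaussian =
      ∫⁻ _, (∫⁻ z, f z ∂stdComplexGaussian) ∂(gaussianArray M) := by simp
  rw [hc]
  -- Integrating over row `k` first, with the other rows frozen, makes `u H` a constant unit vector.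
  refine lintegral_eq_of_lmarginal_eq {k} (hf.comp hm) measurable_const ?_
  ext H
  rw [lmarginal_singleton, lmarginal_singleton]
  simp only [huk, Function.update_self]
  rw [lintegral_const, measure_univ, mul_one]
  conv_rhs => rw [← map_sum_mul_pi_stdComplexGaussian _ (hu1 H), lintegral_map hf (by fun_prop)]

end Beams

/-! ### Leaked interference -/

lemma integral_norm_sq_eq_variance_add {Ω : Type*} [MeasurableSpace Ω] {μ : Measure Ω}
    [IsProbabilityMeasure μ] {X : Ω → ℂ} (hX : MemLp X 2 μ) (h0 : ∫ ω, X ω ∂μ = 0) :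
    ∫ ω, ‖X ω‖ ^ 2 ∂μ = Var[fun ω => (X ω).re; μ] + Var[fun ω => (X ω).im; μ] := by
  have hi : Integrable X μ := hX.integrable (by norm_num)
  have hre : MemLp (fun ω => (X ω).re) 2 μ := hX.re
  have him : MemLp (fun ω => (X ω).im) 2 μ := hX.im
  have h1 : ∫ ω, (X ω).re ∂μ = 0 := by
    have := integral_re hi
    rw [h0] at this
    simpa using this
  have h2 : ∫ ω, (X ω).im ∂μ = 0 := by
    have := integral_im hi
    rw [h0] at this
    simpa using this
  rw [variance_of_integral_eq_zero hre.aemeasurable h1,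
    variance_of_integral_eq_zero him.aemeasurable h2, ← integral_add hre.integrable_sq
    him.integrable_sq]
  refine integral_congr_ae (Filter.Eventually.of_forall fun ω => ?_)
  simp only
  rw [← Complex.normSq_eq_norm_sq, Complex.normSq_apply]
  ring

section Interference

variable {M : ℕ}

/-- The received amplitude `h_k v` as a function of the channel. -/
noncomputable def rowComb (k : Fin M) (v : Fin M → ℂ) : (Fin M → Fin M → ℂ) →L[ℝ] ℂ :=
  ∑ a, v a • ((ContinuousLinearMap.proj a : (Fin M → ℂ) →L[ℝ] ℂ).comp
    (ContinuousLinearMap.proj k : (Fin M → Fin M → ℂ) →L[ℝ] (Fin M → ℂ)))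

lemma rowComb_apply (k : Fin M) (v : Fin M → ℂ) (H : Fin M → Fin M → ℂ) :
    rowComb k v H = ∑ a, H k a * v a := by
  simp [rowComb, sum_apply, mul_comm]

variable (s : ℝ) (β : ℕ)

lemma integral_norm_sq_estErr (k : Fin M) {v : EuclideanSpace ℂ (Fin M)}
    (hv : ∑ a, ‖v a‖ ^ 2 = 1) :
    ∫ ω, ‖rowComb k v (estErr s β ω)‖ ^ 2 ∂(blockLaw M β) = 1 / (1 + β * s ^ 2) := by
  set ℓ := rowComb k v
  have hg : MemLp (fun ω => estErr s β ω) 2 (blockLaw M β) :=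
    (hasGaussianLaw_estErr_obs (gaussianArray M) s β).fst.memLp_two
  have hE := integral_estErr s β (integral_id_gaussianArray M)
  have h1 : ∫ ω, ℓ (estErr s β ω) ∂(blockLaw M β) = 0 := by
    rw [ℓ.integral_comp_comm (hg.integrable (by norm_num))]
    exact (congrArg ℓ hE).trans (map_zero ℓ)
  have h2 : ∫ H, ℓ H ∂(gaussianArray M) = 0 := by
    have hi : Integrable (fun H => H) (gaussianArray M) :=
      IsGaussian.integrable_id (μ := gaussianArray M)
    rw [ℓ.integral_comp_comm hi, integral_id_gaussianArray, map_zero]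
  have h3 : ∫ H, ‖ℓ H‖ ^ 2 ∂(gaussianArray M) = 1 := by
    have h4 := map_row_comb_gaussianArray k (u := fun _ => v) measurable_const (fun _ => hv)
      (fun _ _ => rfl)
    rw [← integral_sq_stdComplexGaussian, ← h4, integral_map
      (by fun_prop : Measurable fun H : Fin M → Fin M → ℂ => ∑ a, H k a * v a).aemeasurable
      (by fun_prop)]
    simp_rw [ℓ, rowComb_apply]
  have hg' : MemLp (fun ω : Block M β => ℓ (estErr s β ω)) 2 (blockLaw M β) := ℓ.comp_memLp' hg
  rw [integral_norm_sq_eq_variance_add hg' h1]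
  rw [integral_norm_sq_eq_variance_add (memLp_dual _ ℓ) h2] at h3
  have hre := variance_estErr (gaussianArray M) s β (Complex.reCLM.comp ℓ)
  have him := variance_estErr (gaussianArray M) s β (Complex.imCLM.comp ℓ)
  refine (congrArg₂ (· + ·) hre him).trans ?_
  rw [← add_div]
  exact congrArg (· / _) h3

/-- The amplitude of the signal meant for user `j` that user `k ≠ j` receives. -/
noncomputable def leak (k j : Fin M) (ω : Block M β) : ℂ :=
  ∑ a, estErr s β ω k a * zfBeam (Matrix.of (lmmse s (obs s β ω))) j a

@[fun_prop]
lemma measurable_leak (k j : Fin M) : Measurable (leak s β k j) := by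
  have h : Measurable fun ω : Block M β => zfBeam (Matrix.of (lmmse s (obs s β ω))) j :=
    (measurable_zfBeam j).comp (by fun_prop)
  unfold leak
  exact Finset.measurable_sum _ fun a _ => by fun_prop

/-- The beam is a function of the pilots and the error is independent of them. Given the pilots the
beam is a fixed unit vector, and every unit vector collects the same mean error power. The Lebesgue
integral avoids presupposing integrability, which is deduced from this value. -/
lemma lintegral_leak (k j : Fin M) :
    ∫⁻ ω, ENNReal.ofReal (‖leak s β k j ω‖ ^ 2) ∂(blockLaw M β) =
      ENNReal.ofReal (1 / (1 + β * s ^ 2)) := by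
  have hind := indepFun_estErr_obs (gaussianArray M) s β
  have hmap := (indepFun_iff_map_prod_eq_prod_map_map (by fun_prop) (by fun_prop)).1 hind
  let F : (Fin M → Fin M → ℂ) × (Fin β → Fin M → Fin M → ℂ) → ENNReal := fun p =>
    ENNReal.ofReal (‖∑ a, p.1 k a * zfBeam (Matrix.of (lmmse s p.2)) j a‖ ^ 2)
  have hF : Measurable F := by
    have h : Measurable fun p : (Fin M → Fin M → ℂ) × (Fin β → Fin M → Fin M → ℂ) =>
        zfBeam (Matrix.of (lmmse s p.2)) j := (measurable_zfBeam j).comp (by fun_prop)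
    refine ENNReal.measurable_ofReal.comp (Measurable.pow_const (Measurable.norm ?_) 2)
    exact Finset.measurable_sum _ fun a _ => by fun_prop
  have h1 : ∫⁻ ω, ENNReal.ofReal (‖leak s β k j ω‖ ^ 2) ∂(blockLaw M β) =
      ∫⁻ p, F p ∂((blockLaw M β).map fun ω => (estErr s β ω, obs s β ω)) := by
    rw [lintegral_map hF (by fun_prop)]
    rfl
  have hp1 : IsProbabilityMeasure ((blockLaw M β).map (obs s β)) :=
    Measure.isProbabilityMeasure_map (by fun_prop)
  have hp2 : IsProbabilityMeasure ((blockLaw M β).map (estErr s β)) :=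
    Measure.isProbabilityMeasure_map (by fun_prop)
  have h2 : ∀ y, ∫⁻ x, F (x, y) ∂((blockLaw M β).map (estErr s β)) =
      ENNReal.ofReal (1 / (1 + β * s ^ 2)) := by
    intro y
    rw [lintegral_map (by fun_prop) (by fun_prop)]
    have hv := sum_norm_sq_zfBeam (Matrix.of (lmmse s y)) j
    rw [← integral_norm_sq_estErr s β k hv, ofReal_integral_eq_lintegral_ofReal]
    · simp_rw [F, rowComb_apply]
    · exact (((rowComb k _).comp_memLp' (hasGaussianLaw_estErr_obs (gaussianArray M) s
        β).fst.memLp_two)).integrable_norm_pow (by norm_num)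
    · exact Filter.Eventually.of_forall fun ω => by positivity
  rw [h1]
  refine (congrArg (fun ν => lintegral ν F) hmap).trans ?_
  rw [lintegral_prod_symm' _ hF]
  have h3 : ∀ y, ∫⁻ x, F (x, y) ∂((signalNoiseLaw (gaussianArray M) β).map (estErr s β)) =
      ENNReal.ofReal (1 / (1 + β * s ^ 2)) := h2
  simp_rw [h3]
  rw [lintegral_const]
  have h4 : (signalNoiseLaw (gaussianArray M) β).map (obs s β) Set.univ = 1 := hp1.measure_univ
  rw [h4, mul_one]

lemma integrable_leak (k j : Fin M) :
    Integrable (fun ω => ‖leak s β k j ω‖ ^ 2) (blockLaw M β) := by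
  refine ⟨by fun_prop, ?_⟩
  rw [hasFiniteIntegral_iff_ofReal (Filter.Eventually.of_forall fun ω => by positivity),
    lintegral_leak]
  exact ENNReal.ofReal_lt_top

lemma integral_leak (k j : Fin M) :
    ∫ ω, ‖leak s β k j ω‖ ^ 2 ∂(blockLaw M β) = 1 / (1 + β * s ^ 2) := by
  rw [integral_eq_lintegral_of_nonneg_ae (Filter.Eventually.of_forall fun ω => by positivity)
    (by fun_prop), lintegral_leak, ENNReal.toReal_ofReal (by positivity)]

end Interference

/-! ### The useful signal -/

section Signal

variable {M : ℕ} (s : ℝ) (β : ℕ)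

lemma lmmse_obs_eq {E : Type*} [NormedAddCommGroup E] [NormedSpace ℝ E] (H : E) (N : Fin β → E) :
    lmmse s (obs s β (H, N)) = (s / (1 + β * s ^ 2) * (β * s)) • H +
      (s / (1 + β * s ^ 2)) • ∑ b, N b := by
  simp only [lmmse, obs, Finset.sum_add_distrib, Finset.sum_const, Finset.card_univ,
    Fintype.card_fin, smul_add, mul_smul, ← Nat.cast_smul_eq_nsmul ℝ]

/-- The amplitude of its own signal at user `k`, up to a phase. -/
noncomputable def ownAmp (k : Fin M) (ω : Block M β) : ℂ :=
  ∑ a, ω.1 k a * adjBeam (Matrix.of (lmmse s (obs s β ω))) k a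

@[fun_prop]
lemma measurable_ownAmp (k : Fin M) : Measurable (ownAmp s β k) := by
  have h : Measurable fun ω : Block M β => adjBeam (Matrix.of (lmmse s (obs s β ω))) k :=
    (measurable_adjBeam k).comp (by fun_prop)
  unfold ownAmp
  exact Finset.measurable_sum _ fun a _ => by fun_prop

/-- With the noise frozen, changing row `k` of the channel changes only row `k` of the estimate,
which the beam for user `k` ignores. So the weights depend only on the other rows. -/
lemma map_ownAmp (k : Fin M) : (blockLaw M β).map (ownAmp s β k) = stdComplexGaussian := by
  refine Measure.ext_of_lintegral _ fun g hg => ?_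
  have hm : Measurable fun ω : Block M β => g (ownAmp s β k ω) := hg.comp (measurable_ownAmp s β k)
  rw [lintegral_map hg (by fun_prop), blockLaw, lintegral_prod_symm' _ hm]
  have h : ∀ N : Fin β → Fin M → Fin M → ℂ,
      ∫⁻ H, g (ownAmp s β k (H, N)) ∂(gaussianArray M) = ∫⁻ z, g z ∂stdComplexGaussian := by
    intro N
    have hu : Measurable fun H : Fin M → Fin M → ℂ =>
        adjBeam (Matrix.of (lmmse s (obs s β (H, N)))) k :=
      (measurable_adjBeam k).comp (by fun_prop)
    have h1 := map_row_comb_gaussianArray k hu (fun H => sum_norm_sq_adjBeam _ k) (by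
      intro H x
      rw [← adjBeam_updateRow (Matrix.of (lmmse s (obs s β (H, N)))) k
        (lmmse s (obs s β (Function.update H k x, N)) k)]
      congr 1
      ext i a
      rw [lmmse_obs_eq, lmmse_obs_eq]
      by_cases hi : i = k
      · subst hi; simp
      · simp [hi])
    rw [← h1, lintegral_map hg (Finset.measurable_sum _ fun a _ => by fun_prop)]
    rfl
  simp_rw [h]
  simp

variable {s β} in
lemma ae_det_lmmse_ne_zero (hs : s ≠ 0) (hβ : β ≠ 0) :
    ∀ᵐ ω ∂(blockLaw M β), (Matrix.of (lmmse s (obs s β ω))).det ≠ 0 := by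
  have hm : Measurable fun ω : Block M β => (Matrix.of (lmmse s (obs s β ω))).det :=
    measurable_det.comp (by fun_prop)
  have hS : MeasurableSet {ω : Block M β | (Matrix.of (lmmse s (obs s β ω))).det = 0} :=
    hm (measurableSet_singleton 0)
  rw [ae_iff]
  simp only [ne_eq, not_not]
  rw [blockLaw, Measure.prod_apply_symm hS]
  have hc : s / (1 + β * s ^ 2) * (β * s) ≠ 0 := by
    have : (1 + β * s ^ 2 : ℝ) ≠ 0 := by positivity
    have : (β : ℝ) ≠ 0 := by exact_mod_cast hβ
    positivity
  have h : ∀ N : Fin β → Fin M → Fin M → ℂ, gaussianArray M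
      ((fun H => (H, N)) ⁻¹' {ω : Block M β | (Matrix.of (lmmse s (obs s β ω))).det = 0}) = 0 := by
    intro N
    have h1 := ae_det_smul_add_ne_zero hc ((s / (1 + β * s ^ 2)) • ∑ b, N b)
    rw [ae_iff] at h1
    simp only [ne_eq, not_not] at h1
    rw [← h1]
    congr 1
    ext H
    simp [lmmse_obs_eq]
  simp_rw [h]
  simp

end Signal

/-! ### Rate loss at a fixed number of cycles -/

/-- Extra interference `J` raises `log (1 + I)` in the denominator by at most `J` and does not lower
the numerator. -/
lemma log_one_add_div_sub_le {x J I : ℝ} (hx : 0 ≤ x) (hJ : 0 ≤ J) (hI : 0 ≤ I) :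
    Real.log (1 + x / (1 + I)) - J ≤ Real.log (1 + x / (1 + J + I)) := by
  have h1 : 1 + x / (1 + I) = (1 + I + x) / (1 + I) := by field_simp
  have h2 : 1 + x / (1 + J + I) = (1 + J + I + x) / (1 + J + I) := by field_simp
  rw [h1, h2, Real.log_div (by positivity) (by positivity),
    Real.log_div (by positivity) (by positivity)]
  have h3 : Real.log (1 + I + x) ≤ Real.log (1 + J + I + x) :=
    Real.log_le_log (by positivity) (by linarith)
  have h4 : Real.log (1 + J + I) - Real.log (1 + I) ≤ J := by
    rw [← Real.log_div (by positivity) (by positivity)]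
    refine (Real.log_le_sub_one_of_pos (by positivity)).trans ?_
    rw [div_sub_one (by positivity), div_le_iff₀ (by positivity)]
    nlinarith
  linarith

/-- The rate loss caused by interference is a concave function of the gain; this is its tangent
inequality at the gain `p`. -/
lemma log_one_add_sub_le_tangent {x p I : ℝ} (hx : 0 ≤ x) (hp : 0 ≤ p) (hI : 0 ≤ I) :
    Real.log (1 + x) - Real.log (1 + x / (1 + I)) ≤
      Real.log ((1 + I) / (1 + I / (1 + p))) + I / ((1 + p) * (1 + I + p)) * (x - p) := by
  have h1 : 1 + x / (1 + I) = (1 + I + x) / (1 + I) := by field_simp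
  have h2 : (1 + I) / (1 + I / (1 + p)) = (1 + I) * (1 + p) / (1 + I + p) := by
    field_simp
    ring
  rw [h1, h2, Real.log_div (by positivity) (by positivity),
    Real.log_div (by positivity) (by positivity), Real.log_mul (by positivity) (by positivity)]
  set y := (1 + I + p) * (1 + x) / ((1 + I + x) * (1 + p)) with hy
  -- `log y` is the loss at `x` minus the loss at `p`. The tangent term exceeds `y - 1` by an
  -- explicit multiple of `(x - p) ^ 2`.
  have h3 : Real.log y ≤ y - 1 := Real.log_le_sub_one_of_pos (by positivity)
  have h4 : Real.log y = Real.log (1 + I + p) + Real.log (1 + x) -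
      (Real.log (1 + I + x) + Real.log (1 + p)) := by
    rw [hy, Real.log_div (by positivity) (by positivity), Real.log_mul (by positivity)
      (by positivity), Real.log_mul (by positivity) (by positivity)]
  have h5 : y - 1 ≤ I / ((1 + p) * (1 + I + p)) * (x - p) := by
    have h6 : I / ((1 + p) * (1 + I + p)) * (x - p) - (y - 1) =
        I * (x - p) ^ 2 / ((1 + p) * (1 + I + p) * (1 + I + x)) := by
      rw [hy]
      field_simp
      ring
    have h7 : 0 ≤ I * (x - p) ^ 2 / ((1 + p) * (1 + I + p) * (1 + I + x)) := by positivity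
    linarith
  linarith

lemma integrable_log_one_add {Ω : Type*} [MeasurableSpace Ω] {μ : Measure Ω} {X : Ω → ℝ}
    (hX : Integrable X μ) (h0 : ∀ ω, 0 ≤ X ω) : Integrable (fun ω => Real.log (1 + X ω)) μ := by
  refine hX.mono' (Real.measurable_log.comp_aemeasurable
    (hX.aemeasurable.const_add 1)).aestronglyMeasurable (Filter.Eventually.of_forall fun ω => ?_)
  rw [Real.norm_of_nonneg (Real.log_nonneg (by linarith [h0 ω]))]
  linarith [Real.log_le_sub_one_of_pos (show 0 < 1 + X ω by linarith [h0 ω])]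

/-- The mean loss caused by interference of power `I`, for a `CN(0,1)` amplitude and mean received
power `p`, is at most the loss at a gain equal to its mean. -/
lemma integral_log_sub_le {p I : ℝ} (hp : 0 ≤ p) (hI : 0 ≤ I) :
    ∫ z, Real.log (1 + p * ‖z‖ ^ 2) ∂stdComplexGaussian -
      ∫ z, Real.log (1 + p * ‖z‖ ^ 2 / (1 + I)) ∂stdComplexGaussian ≤
      Real.log ((1 + I) / (1 + I / (1 + p))) := by
  have hi := integrable_sq_stdComplexGaussian.const_mul p
  have hi1 := integrable_log_one_add hi (fun z => by positivity)
  have hi2 := integrable_log_one_add (hi.div_const (1 + I)) (fun z => by positivity)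
  rw [← integral_sub hi1 hi2]
  have hi3 : Integrable (fun z : ℂ => p * ‖z‖ ^ 2 - p) stdComplexGaussian :=
    hi.sub (integrable_const p)
  have hi4 := hi3.const_mul (I / ((1 + p) * (1 + I + p)))
  have hi5 := (integrable_const (μ := stdComplexGaussian)
    (Real.log ((1 + I) / (1 + I / (1 + p))))).add hi4
  refine (integral_mono (hi1.sub hi2) hi5
    (fun z => log_one_add_sub_le_tangent (by positivity) hp hI)).trans (le_of_eq ?_)
  refine (integral_add (integrable_const _) hi4).trans ?_
  rw [integral_const_mul, integral_sub hi (integrable_const p),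
    integral_const_mul, integral_sq_stdComplexGaussian]
  simp

variable {M : ℕ}

lemma rateZF_eq (P : ℝ) (k : Fin M) :
    rateZF M P k = ∫ z, Real.log (1 + P / M * ‖z‖ ^ 2) ∂stdComplexGaussian := by
  have hu : Measurable fun H : Fin M → Fin M → ℂ => adjBeam (Matrix.of H) k := by fun_prop
  have hlaw := map_row_comb_gaussianArray k hu (fun H => sum_norm_sq_adjBeam _ k)
    (fun H x => adjBeam_updateRow (Matrix.of H) k x)
  have hm : Measurable fun H : Fin M → Fin M → ℂ => ∑ a, H k a * adjBeam (Matrix.of H) k a :=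
    Finset.measurable_sum _ fun a _ => by fun_prop
  rw [← hlaw, integral_map hm.aemeasurable
    (by fun_prop : Measurable fun z : ℂ => Real.log (1 + P / M * ‖z‖ ^ 2)).aestronglyMeasurable]
  have hdet := ae_det_smul_add_ne_zero (M := M) one_ne_zero 0
  refine integral_congr_ae ?_
  filter_upwards [hdet] with H hH
  rw [one_smul, add_zero] at hH
  have h0 : ∀ j ∈ Finset.univ.erase k, P / M * beamGain (Matrix.of H) (Matrix.of H) k j = 0 := by
    intro j hj
    rw [beamGain, sum_mul_zfBeam_of_ne hH (Finset.ne_of_mem_erase hj).symm]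
    simp
  rw [sinr, Finset.sum_eq_zero h0, beamGain, norm_sum_mul_zfBeam hH]
  simp

/-- The rate loss due to imperfect channel knowledge and to interference of power `I`. -/
lemma rateZF_sub_rate_le {P f I : ℝ} (hP : 0 < P) (hf : 0 < f) (hI : 0 ≤ I) {β : ℕ} (hβ : β ≠ 0)
    (k : Fin M) :
    rateZF M P k - rate M P f I β k ≤
      Real.log ((1 + I) / (1 + I / (1 + P / M))) + 1 / (f * β) := by
  set s := Real.sqrt (f * P)
  have hs : s ≠ 0 := (Real.sqrt_pos.2 (by positivity)).ne'
  have hs2 : s ^ 2 = f * P := Real.sq_sqrt (by positivity)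
  have hM : (0 : ℝ) < M := by exact_mod_cast k.pos
  have hβ' : (0 : ℝ) < β := by exact_mod_cast Nat.pos_of_ne_zero hβ
  set J : Block M β → ℝ := fun ω => ∑ j ∈ Finset.univ.erase k, P / M * ‖leak s β k j ω‖ ^ 2
  set S : Block M β → ℝ := fun ω => P / M * ‖ownAmp s β k ω‖ ^ 2
  have hJ0 : ∀ ω, 0 ≤ J ω := fun ω => Finset.sum_nonneg fun j _ => by positivity
  have hS0 : ∀ ω, 0 ≤ S ω := fun ω => by positivity
  have hJm : Measurable J := by fun_prop
  have hSm : Measurable S := by fun_prop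
  have hJi : Integrable J (blockLaw M β) :=
    integrable_finsetSum _ fun j _ => (integrable_leak s β k j).const_mul _
  have hSi : Integrable S (blockLaw M β) := by
    have h := integrable_sq_stdComplexGaussian
    rw [← map_ownAmp s β k] at h
    exact (h.comp_measurable (measurable_ownAmp s β k)).const_mul _
  have hrate : rate M P f I β k =
      ∫ ω, Real.log (1 + S ω / (1 + J ω + I)) ∂(blockLaw M β) := by
    refine integral_congr_ae ?_
    filter_upwards [mmseEstimate_ae_eq M β P f, ae_det_lmmse_ne_zero hs hβ] with ω h1 h2
    rw [h1]
    set G := Matrix.of (lmmse s (obs s β ω)) with hG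
    have h3 : beamGain (Matrix.of ω.1) G k k = ‖ownAmp s β k ω‖ ^ 2 := by
      rw [beamGain, norm_sum_mul_zfBeam h2]
      rfl
    have h4 : ∀ j ∈ Finset.univ.erase k,
        P / M * beamGain (Matrix.of ω.1) G k j = P / M * ‖leak s β k j ω‖ ^ 2 := by
      intro j hj
      -- The estimated row annihilates this beam, so subtracting it replaces the channel by its
      -- estimation error.
      have h5 := sum_mul_zfBeam_of_ne h2 (Finset.ne_of_mem_erase hj).symm
      have h6 : ∑ a, Matrix.of ω.1 k a * zfBeam G j a = leak s β k j ω := by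
        rw [leak, ← sub_zero (∑ a, Matrix.of ω.1 k a * zfBeam G j a), ← h5,
          ← Finset.sum_sub_distrib]
        refine Finset.sum_congr rfl fun a _ => ?_
        simp [estErr, hG, sub_mul]
      rw [beamGain, h6]
    rw [sinr, h3, Finset.sum_congr rfl h4]
  have hi1 : Integrable (fun ω => Real.log (1 + S ω / (1 + J ω + I))) (blockLaw M β) := by
    refine integrable_log_one_add (hSi.mono'
      (hSm.div ((hJm.const_add 1).add_const I)).aestronglyMeasurable (Filter.Eventually.of_forall fun ω =>
      ?_)) fun ω => div_nonneg (hS0 ω) (by linarith [hJ0 ω])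
    rw [Real.norm_of_nonneg (div_nonneg (hS0 ω) (by linarith [hJ0 ω]))]
    exact div_le_self (hS0 ω) (by linarith [hJ0 ω])
  have hi2 : Integrable (fun ω => Real.log (1 + S ω / (1 + I))) (blockLaw M β) :=
    integrable_log_one_add (hSi.div_const _) fun ω => div_nonneg (hS0 ω) (by linarith)
  have h1 : ∫ ω, Real.log (1 + S ω / (1 + I)) ∂(blockLaw M β) - ∫ ω, J ω ∂(blockLaw M β) ≤
      rate M P f I β k := by
    rw [hrate, ← integral_sub hi2 hJi]
    exact integral_mono (hi2.sub hJi) hi1 fun ω => log_one_add_div_sub_le (hS0 ω) (hJ0 ω) hI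
  have h2 : ∫ ω, Real.log (1 + S ω / (1 + I)) ∂(blockLaw M β) =
      ∫ z, Real.log (1 + P / M * ‖z‖ ^ 2 / (1 + I)) ∂stdComplexGaussian := by
    rw [← map_ownAmp s β k, integral_map (by fun_prop) (by fun_prop :
      Measurable fun z : ℂ => Real.log (1 + P / M * ‖z‖ ^ 2 / (1 + I))).aestronglyMeasurable]
  have h3 : ∫ ω, J ω ∂(blockLaw M β) ≤ 1 / (f * β) := by
    rw [integral_finsetSum _ fun j _ => (integrable_leak s β k j).const_mul _]
    simp_rw [integral_const_mul, integral_leak, hs2]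
    rw [Finset.sum_const, nsmul_eq_mul]
    -- Counting `M` interferers instead of `M - 1` cancels the `M` in `P / M`.
    have hcard : ((Finset.univ.erase k).card : ℝ) ≤ M := by
      exact_mod_cast (Finset.card_le_univ _).trans (by simp)
    refine (mul_le_mul_of_nonneg_right hcard (by positivity)).trans ?_
    have h4 : (M : ℝ) * (P / M * (1 / (1 + β * (f * P)))) = P / (1 + β * (f * P)) := by
      field_simp
    rw [h4, div_le_div_iff₀ (by positivity) (by positivity)]
    linarith
  have h4 := integral_log_sub_le (p := P / M) (by positivity) hI
  rw [rateZF_eq]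
  linarith

lemma rate_nonneg {P f I : ℝ} (hP : 0 ≤ P) (hI : 0 ≤ I) (β : ℕ) (k : Fin M) :
    0 ≤ rate M P f I β k := by
  refine integral_nonneg fun ω => Real.log_nonneg ?_
  have h : ∀ j, 0 ≤ P / M * beamGain (Matrix.of ω.1) (mmseEstimate M β P f ω) k j := fun j =>
    mul_nonneg (by positivity) (sq_nonneg _)
  have h2 := Finset.sum_nonneg fun j (_ : j ∈ Finset.univ.erase k) => h j
  have h3 : 0 ≤ sinr P I (Matrix.of ω.1) (mmseEstimate M β P f ω) k :=
    div_nonneg (h k) (by linarith)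
  linarith

/-! ### Choice of the training length -/

open Filter Topology

variable {P f α : ℝ}

lemma lossINI_pos (hM : 0 < M) (hP : 0 < P) (hf : 0 < f) (hα : 0 < α) : 0 < lossINI M P f α := by
  have hM' : (0 : ℝ) < M := by exact_mod_cast hM
  refine Real.log_pos ?_
  rw [one_lt_div (by positivity)]
  have : α * f * P / (1 + P / M) < α * f * P :=
    div_lt_self (by positivity) (by linarith [div_pos hP hM'])
  linarith

lemma rateZF_sub_rateData_le (hP : 0 < P) (hf : 0 < f) {β : ℕ} (hβ : β ≠ 0) (k : Fin M) :
    rateZF M P k - 1 / (f * β) ≤ rateData M P f β k := by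
  have h := rateZF_sub_rate_le hP hf le_rfl hβ k
  simp only [add_zero, zero_div, div_one, Real.log_one, zero_add] at h
  rw [rateData]
  linarith

lemma rateZF_sub_rateINI_le (hP : 0 < P) (hf : 0 < f) (hα : 0 < α) {β : ℕ} (hβ : β ≠ 0)
    (k : Fin M) :
    rateZF M P k - lossINI M P f α - 1 / (f * β) ≤ rateINI M P f α β k := by
  have h := rateZF_sub_rate_le hP hf (I := α * f * P) (by positivity) hβ k
  rw [rateINI, lossINI]
  linarith

lemma rateZF_nonneg (hP : 0 ≤ P) (k : Fin M) : 0 ≤ rateZF M P k := by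
  rw [rateZF_eq]
  refine integral_nonneg fun z => Real.log_nonneg ?_
  have : 0 ≤ P / M * ‖z‖ ^ 2 := by positivity
  linarith

/-- For a fixed number of complete cycles the efficiency is nonincreasing in `τ`, as the data rate
is nonnegative. Rounding down to a multiple of `M` loses nothing and leaves finitely many
candidates. -/
lemma exists_isOptimalLen (hP : 0 < P) (k : Fin M) {T : ℕ} (hT : 0 < T) :
    ∃ τ : ℝ, IsOptimalLen M P f α k T τ := by
  have hM : (0 : ℝ) < M := by exact_mod_cast k.pos
  have hM1 : (1 : ℝ) ≤ M := by exact_mod_cast k.pos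
  have hT' : (0 : ℝ) < T := by exact_mod_cast hT
  obtain ⟨n, hn, hmax⟩ := ((Finset.range T).filter fun n : ℕ => (n : ℝ) * M < T).exists_max_image
    (fun n => arCAB M P f α k T (n * M)) ⟨0, by simp [hT]⟩
  simp only [Finset.mem_filter, Finset.mem_range] at hn hmax
  refine ⟨n * M, ⟨by positivity, hn.2⟩, fun τ hτ => ?_⟩
  have h1 : (⌊τ / M⌋₊ : ℝ) * M ≤ τ := by
    rw [← le_div_iff₀ hM]
    exact Nat.floor_le (div_nonneg hτ.1 hM.le)
  have h2 : (⌊τ / M⌋₊ : ℝ) * M < T := h1.trans_lt hτ.2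
  have h3 : ⌊τ / M⌋₊ < T := by
    have : (⌊τ / M⌋₊ : ℝ) < T := (le_mul_of_one_le_right (by positivity) hM1).trans_lt h2
    exact_mod_cast this
  refine le_trans ?_ (hmax _ ⟨h3, h2⟩)
  have h4 : ⌊(⌊τ / M⌋₊ : ℝ) * M / M⌋₊ = ⌊τ / M⌋₊ := by
    rw [mul_div_cancel_right₀ _ hM.ne', Nat.floor_natCast]
  simp only [arCAB, h4]
  have h5 : 0 ≤ rateData M P f ⌊τ / M⌋₊ k := rate_nonneg hP.le le_rfl _ k
  gcongr

section TrainLen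

variable {c T : ℝ}

lemma quadratic_root_pos (hc : 0 < c) (hT : 0 < T) :
    0 < (Real.sqrt (4 * c * T + 1) - 1) / (2 * c) := by
  have : 1 < Real.sqrt (4 * c * T + 1) := Real.lt_sqrt_of_sq_lt (by nlinarith [mul_pos hc hT])
  exact div_pos (by linarith) (by positivity)

/-- The equation `c x ^ 2 + x = T` gives both `x < T` and `x ≤ √(T / c)`, since its two terms are
positive. -/
lemma quadratic_root_spec (hc : 0 < c) (hT : 0 < T) :
    c * ((Real.sqrt (4 * c * T + 1) - 1) / (2 * c)) ^ 2 +
      (Real.sqrt (4 * c * T + 1) - 1) / (2 * c) = T := by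
  have h : Real.sqrt (4 * c * T + 1) ^ 2 = 4 * c * T + 1 := Real.sq_sqrt (by positivity)
  generalize Real.sqrt (4 * c * T + 1) = y at h
  field_simp
  linarith

lemma quadratic_root_le (hc : 0 < c) (hT : 0 < T) :
    (Real.sqrt (4 * c * T + 1) - 1) / (2 * c) ≤ Real.sqrt (T / c) := by
  refine Real.le_sqrt_of_sq_le ?_
  rw [le_div_iff₀ hc]
  linarith [quadratic_root_spec hc hT, quadratic_root_pos hc hT]

lemma le_quadratic_root (hc : 0 < c) (hT : 0 < T) :
    Real.sqrt (T / c) - 1 / (2 * c) ≤ (Real.sqrt (4 * c * T + 1) - 1) / (2 * c) := by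
  have h1 : Real.sqrt (T / c) = Real.sqrt (4 * c * T) / (2 * c) := by
    rw [Real.sqrt_eq_iff_mul_self_eq (by positivity) (by positivity), ← pow_two, div_pow,
      Real.sq_sqrt (by positivity)]
    field_simp
    ring
  rw [h1, ← sub_div]
  gcongr
  linarith

end TrainLen

lemma trainLen_mem_Ico (hM : 0 < M) (hP : 0 < P) (hf : 0 < f) (hα : 0 < α) {T : ℕ} (hT : 0 < T) :
    trainLen M P f α T ∈ Set.Ico (0 : ℝ) T := by
  have hΔ := lossINI_pos hM hP hf hα
  have hM' : (0 : ℝ) < M := by exact_mod_cast hM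
  have hT' : (0 : ℝ) < T := by exact_mod_cast hT
  have hc : 0 < f * lossINI M P f α / M := by positivity
  have h1 := quadratic_root_pos hc hT'
  have h2 := quadratic_root_spec hc hT'
  refine ⟨h1.le, ?_⟩
  change (Real.sqrt (4 * (f * lossINI M P f α / M) * T + 1) - 1) /
    (2 * (f * lossINI M P f α / M)) < (T : ℝ)
  nlinarith [mul_pos hc (pow_pos h1 2)]

/-- The difference of roots is `1 / (√(m + 1) + √m)`, and `√(m + 1) ≤ 2 √m ≤ 2 m`. Telescoping
bounds the harmonic sum by a square root: cruder than a logarithm, but still negligible after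
division by `T`. -/
lemma inv_le_three_mul_sqrt_sub {m : ℝ} (hm : 1 ≤ m) :
    1 / m ≤ 3 * (Real.sqrt (m + 1) - Real.sqrt m) := by
  have ha : Real.sqrt m ^ 2 = m := Real.sq_sqrt (by linarith)
  have hb : Real.sqrt (m + 1) ^ 2 = m + 1 := Real.sq_sqrt (by linarith)
  have ha1 : 1 ≤ Real.sqrt m := Real.one_le_sqrt.2 hm
  set a := Real.sqrt m
  set b := Real.sqrt (m + 1)
  have hb2 : b ≤ 2 * a := by
    refine abs_le_of_sq_le_sq' ?_ (by linarith) |>.2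
    nlinarith
  have hb0 : 0 ≤ b := Real.sqrt_nonneg _
  have hba : 0 ≤ b - a := by nlinarith
  rw [div_le_iff₀ (by linarith)]
  have h1 : 1 = (b - a) * (b + a) := by nlinarith
  have h2 : (b - a) * (b + a) ≤ (b - a) * (3 * m) := by
    refine mul_le_mul_of_nonneg_left ?_ hba
    nlinarith
  linarith

lemma sum_Icc_two_inv_le (n : ℕ) :
    ∑ j ∈ Finset.Icc 2 n, 1 / ((j - 1 : ℕ) : ℝ) ≤ 3 * Real.sqrt n := by
  induction n with
  | zero => simp
  | succ n ih =>
    rcases Nat.eq_zero_or_pos n with rfl | hn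
    · simp
    · rw [Finset.sum_Icc_succ_top (by omega)]
      have := inv_le_three_mul_sqrt_sub (m := n) (by exact_mod_cast hn)
      push_cast [Nat.add_sub_cancel]
      linarith

/-- A bound for the loss at any training length of more than one cycle. -/
lemma rateZF_sub_arCAB_le (hP : 0 < P) (hf : 0 < f) (hα : 0 < α) (k : Fin M) {T : ℕ} {x : ℝ}
    (hxM : (M : ℝ) < x) (hxT : x < T) :
    rateZF M P k - arCAB M P f α k T x ≤
      2 * M * rateZF M P k / T + M / (f * (x - M)) + x * lossINI M P f α / T +
        3 * M * Real.sqrt x / (f * T) := by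
  have hM : (0 : ℝ) < M := by exact_mod_cast k.pos
  have hM1 : (1 : ℝ) ≤ M := by exact_mod_cast k.pos
  have hT : (0 : ℝ) < T := by linarith
  have hx : 0 < x := by linarith
  have hΔ := lossINI_pos k.pos hP hf hα
  have hA := rateZF_nonneg hP.le k
  set A := rateZF M P k
  set Δ := lossINI M P f α
  set n := ⌊x / M⌋₊ with hn
  have hn1 : 1 ≤ n := Nat.le_floor (by rw [Nat.cast_one, le_div_iff₀ hM]; linarith)
  have hn1' : (1 : ℝ) ≤ n := by exact_mod_cast hn1
  have hnx : (n : ℝ) * M ≤ x := by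
    rw [← le_div_iff₀ hM]; exact Nat.floor_le (by positivity)
  have hxn : x < (n + 1) * M := by
    rw [← div_lt_iff₀ hM]; exact Nat.lt_floor_add_one _
  have h1 : A - 1 / (f * n) ≤ rateData M P f n k :=
    rateZF_sub_rateData_le hP hf (by omega) k
  -- Of the `M` symbols of a cycle, the user's own pilot symbol is free of inter-node interference;
  -- hence `M - 1` losses `Δ`.
  have h2 : ∀ j ∈ Finset.Icc 2 n, (M * A - (M - 1) * Δ) - M / f * (1 / ((j - 1 : ℕ) : ℝ)) ≤
      rateData M P f (j - 1) k + (M - 1) * rateINI M P f α (j - 1) k := by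
    intro j hj
    have hj2 := (Finset.mem_Icc.1 hj).1
    have h3 := rateZF_sub_rateData_le hP hf (β := j - 1) (by omega) k
    have h4 := mul_le_mul_of_nonneg_left
      (rateZF_sub_rateINI_le hP hf hα (β := j - 1) (by omega) k) (sub_nonneg.2 hM1)
    have h5 : M / f * (1 / ((j - 1 : ℕ) : ℝ)) = M * (1 / (f * ((j - 1 : ℕ) : ℝ))) := by
      rw [div_mul_div_comm, mul_one, mul_one_div]
    rw [h5]
    linarith
  have h3 := Finset.sum_le_sum h2
  rw [Finset.sum_sub_distrib, ← Finset.mul_sum, Finset.sum_const, Nat.card_Icc,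
    nsmul_eq_mul] at h3
  have h4 : ((n + 1 - 2 : ℕ) : ℝ) = n - 1 := by
    rw [show n + 1 - 2 = n - 1 by omega, Nat.cast_sub hn1, Nat.cast_one]
  rw [h4] at h3
  have h5 : M / f * ∑ j ∈ Finset.Icc 2 n, 1 / ((j - 1 : ℕ) : ℝ) ≤ 3 * M * Real.sqrt x / f := by
    have h6 : Real.sqrt n ≤ Real.sqrt x := Real.sqrt_le_sqrt (by nlinarith)
    have h7 := (sum_Icc_two_inv_le n).trans (mul_le_mul_of_nonneg_left h6 (by norm_num))
    refine (mul_le_mul_of_nonneg_left h7 (by positivity)).trans (le_of_eq (by ring))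
  have h6 : 1 / (f * n) ≤ M / (f * (x - M)) := by
    rw [div_le_div_iff₀ (by positivity) (mul_pos hf (by linarith))]
    nlinarith
  have h7 : (T - x) / T * A - M / (f * (x - M)) ≤ (T - x) / T * rateData M P f n k := by
    have h8 : (T - x) / T ≤ 1 := by rw [div_le_one hT]; linarith
    have h9 : 0 ≤ (T - x) / T := div_nonneg (by linarith) hT.le
    have h10 := mul_le_mul_of_nonneg_left h1 h9
    have h11 : 0 ≤ 1 / (f * n) := by positivity
    nlinarith
  have h8 : (n - 1) * (M * A - (M - 1) * Δ) - 3 * M * Real.sqrt x / f ≤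
      ∑ j ∈ Finset.Icc 2 n, (rateData M P f (j - 1) k + (M - 1) * rateINI M P f α (j - 1) k) := by
    linarith
  -- The silent first cycle and the incomplete last one waste at most `2 * M` symbols.
  have h9 : x * A - 2 * M * A - x * Δ ≤ (n - 1) * (M * A - (M - 1) * Δ) := by
    have h10 : (x - (n - 1) * M) * A ≤ 2 * M * A :=
      mul_le_mul_of_nonneg_right (by linarith) hA
    have h11 : (n - 1) * (M - 1) * Δ ≤ x * Δ :=
      mul_le_mul_of_nonneg_right (by nlinarith) hΔ.le
    linarith
  rw [arCAB, ← hn]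
  have h11 : (T - x) / T * A + 1 / T * (x * A - 2 * M * A - x * Δ - 3 * M * Real.sqrt x / f) =
      A - 2 * M * A / T - x * Δ / T - 3 * M * Real.sqrt x / (f * T) := by
    field_simp
    ring
  have h12 := mul_le_mul_of_nonneg_left ((sub_le_sub_right h9 _).trans h8)
    (by positivity : (0 : ℝ) ≤ 1 / T)
  linarith

lemma tendsto_excess (a b d K : ℝ) :
    Tendsto (fun w : ℝ => a / w + b / (w - K) + d / Real.sqrt w) atTop (𝓝 0) := by
  have h1 : Tendsto (fun w : ℝ => a / w) atTop (𝓝 0) := tendsto_id.const_div_atTop a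
  have h2 : Tendsto (fun w : ℝ => b / (w - K)) atTop (𝓝 0) :=
    (tendsto_atTop_add_const_right atTop (-K) tendsto_id).const_div_atTop b
  have h3 : Tendsto (fun w : ℝ => d / Real.sqrt w) atTop (𝓝 0) :=
    Real.tendsto_sqrt_atTop.const_div_atTop d
  simpa using (h1.add h2).add h3

lemma rateZF_sub_arCAB_trainLen_le (hP : 0 < P) (hf : 0 < f) (hα : 0 < α) (k : Fin M) {T : ℕ}
    (hT : 0 < T) {c w K : ℝ} (hc : c = f * lossINI M P f α / M) (hw : w = Real.sqrt (T / c))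
    (hK : K = M + 1 / (2 * c)) (hKw : K < w) :
    rateZF M P k - arCAB M P f α k T (trainLen M P f α T) ≤
      2 * Real.sqrt (M * lossINI M P f α / (f * T)) + 1 / Real.sqrt T *
        (2 * M * rateZF M P k / Real.sqrt c / w + M * K * Real.sqrt c / f / (w - K) +
          3 * M / f / Real.sqrt c / Real.sqrt w) := by
  have hM : (0 : ℝ) < M := by exact_mod_cast k.pos
  have hT' : (0 : ℝ) < T := by exact_mod_cast hT
  have hΔ := lossINI_pos k.pos hP hf hα
  have hc0 : 0 < c := by rw [hc]; positivity
  have hK0 : 0 < K := by rw [hK]; positivity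
  have hw0 : 0 < w := hK0.trans hKw
  have hTw : Real.sqrt T = Real.sqrt c * w := by
    rw [hw, Real.sqrt_div hT'.le, mul_div_cancel₀ _ (Real.sqrt_pos.2 hc0).ne']
  have hx := trainLen_mem_Ico k.pos hP hf hα hT
  have hxw : trainLen M P f α T ≤ w := by
    rw [hw, hc]; exact quadratic_root_le (hc ▸ hc0) hT'
  have hwx : w - 1 / (2 * c) ≤ trainLen M P f α T := by
    rw [hw, hc]; exact le_quadratic_root (hc ▸ hc0) hT'
  set x := trainLen M P f α T
  set A := rateZF M P k
  -- `K` collects the rounding loss `M` and the distance `1 / (2 c)` of the root from `w`.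
  have hKx : w - K ≤ x - M := by rw [hK]; linarith
  have h1 := rateZF_sub_arCAB_le hP hf hα k (by linarith : (M : ℝ) < x) hx.2
  refine h1.trans ?_
  set Δ := lossINI M P f α
  set q := Real.sqrt c
  have hq0 : 0 < q := Real.sqrt_pos.2 hc0
  have hqc : q ^ 2 = f * Δ / M := by rw [← hc]; exact Real.sq_sqrt hc0.le
  have hTq : (T : ℝ) = (q * w) ^ 2 := by rw [← hTw, Real.sq_sqrt hT'.le]
  have hΔq : Δ = q ^ 2 * M / f := by rw [hqc]; field_simp
  have hmain : Real.sqrt (M * Δ / (f * T)) = M / (f * w) := by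
    rw [Real.sqrt_eq_iff_mul_self_eq (by positivity) (by positivity), hTq, hΔq]
    field_simp
  have h2 : M / (f * (x - M)) ≤ M / (f * w) + M * K / (f * w * (w - K)) := by
    have h3 : M / (f * (x - M)) ≤ M / (f * (w - K)) := by
      have := sub_pos.2 hKw
      gcongr
    refine h3.trans (le_of_eq ?_)
    have := (sub_pos.2 hKw).ne'
    field_simp
    ring
  have h3 : x * Δ / T ≤ M / (f * w) := by
    have h4 : w * Δ / T = M / (f * w) := by
      rw [hTq, hΔq]
      field_simp
    rw [← h4]
    gcongr
  have h4 : 3 * M * Real.sqrt x / (f * T) ≤ 3 * M * Real.sqrt w / (f * T) := by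
    gcongr
  have h5 : 3 * M * Real.sqrt w / (f * T) = 1 / (q * w) * (3 * M / f / q / Real.sqrt w) := by
    have hww : w = Real.sqrt w ^ 2 := (Real.sq_sqrt hw0.le).symm
    have hw1 : 0 < Real.sqrt w := Real.sqrt_pos.2 hw0
    rw [hTq]
    generalize Real.sqrt w = v at hww hw1
    rw [hww]
    field_simp
  have h6 : M * K / (f * w * (w - K)) = 1 / (q * w) * (M * K * q / f / (w - K)) := by
    have := (sub_pos.2 hKw).ne'
    field_simp
  have h7 : 2 * M * A / T = 1 / (q * w) * (2 * M * A / q / w) := by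
    rw [hTq]
    field_simp
  rw [hmain, hTw, mul_add, mul_add, ← h5, ← h6, ← h7]
  linarith

lemma exists_isLittleO_excess (hP : 0 < P) (hf : 0 < f) (hα : 0 < α) (k : Fin M) :
    ∃ ε : ℕ → ℝ, ε =o[atTop] (fun T : ℕ => 1 / Real.sqrt (T : ℝ)) ∧
      ∀ T : ℕ, 0 < T → rateZF M P k - arCAB M P f α k T (trainLen M P f α T) ≤
        2 * Real.sqrt (M * lossINI M P f α / (f * T)) + ε T := by
  have hM : (0 : ℝ) < M := by exact_mod_cast k.pos
  have hΔ := lossINI_pos k.pos hP hf hα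
  obtain ⟨c, hc⟩ : ∃ c, c = f * lossINI M P f α / M := ⟨_, rfl⟩
  have hc0 : 0 < c := by rw [hc]; positivity
  obtain ⟨K, hK⟩ : ∃ K, K = M + 1 / (2 * c) := ⟨_, rfl⟩
  have hw : Tendsto (fun T : ℕ => Real.sqrt (T / c)) atTop atTop :=
    Real.tendsto_sqrt_atTop.comp (tendsto_natCast_atTop_atTop.atTop_div_const hc0)
  have hlim := (tendsto_excess (2 * M * rateZF M P k / Real.sqrt c) (M * K * Real.sqrt c / f)
    (3 * M / f / Real.sqrt c) K).comp hw
  -- Taking `ε` as the positive part of the excess makes the bound hold for every `T`; the explicit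
  -- estimate is needed only eventually, once `K < √(T / c)`.
  refine ⟨fun T => max 0 (rateZF M P k - arCAB M P f α k T (trainLen M P f α T) -
    2 * Real.sqrt (M * lossINI M P f α / (f * T))), ?_, fun T _ => ?_⟩
  · refine (Asymptotics.isLittleO_iff_tendsto' ?_).2 ?_
    · filter_upwards [eventually_gt_atTop 0] with T hT h0
      have : (0 : ℝ) < T := by exact_mod_cast hT
      exact absurd h0 (by positivity)
    · have hmax := hlim.max (tendsto_const_nhds (x := (0 : ℝ)))
      rw [max_self] at hmax
      refine squeeze_zero' (Eventually.of_forall fun T => by positivity) ?_ hmax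
      filter_upwards [eventually_gt_atTop 0, hw.eventually_gt_atTop K] with T hT hKw
      have hT' : (0 : ℝ) < T := by exact_mod_cast hT
      have h := rateZF_sub_arCAB_trainLen_le hP hf hα k hT hc rfl hK hKw
      rw [div_le_iff₀ (by positivity)]
      refine max_le (by positivity) ?_
      have h2 := mul_le_mul_of_nonneg_right (le_max_left ((fun w : ℝ =>
        2 * M * rateZF M P k / Real.sqrt c / w + M * K * Real.sqrt c / f / (w - K) +
          3 * M / f / Real.sqrt c / Real.sqrt w) (Real.sqrt (T / c))) 0)
        (by positivity : 0 ≤ 1 / Real.sqrt T)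
      refine le_trans ?_ h2
      rw [mul_comm]
      linarith
  · linarith [le_max_right 0 (rateZF M P k - arCAB M P f α k T (trainLen M P f α T) -
      2 * Real.sqrt (M * lossINI M P f α / (f * T)))]

end CAB

theorem theorem4 (M : ℕ) (P f α : ℝ) (hP : 0 < P) (hf : 0 < f) (hf1 : f ≤ 1) (hα : 0 < α)
    (k : Fin M) :
    (∀ T : ℕ, 0 < T →
      (∃ τ : ℝ, CAB.IsOptimalLen M P f α k T τ) ∧
      ∀ τ : ℝ, CAB.IsOptimalLen M P f α k T τ →
        CAB.rateZF M P k - CAB.arCAB M P f α k T τ ≤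
          CAB.rateZF M P k - CAB.arCAB M P f α k T (CAB.trainLen M P f α T)) ∧
    ∃ ε : ℕ → ℝ,
      Asymptotics.IsLittleO Filter.atTop ε (fun T : ℕ => 1 / Real.sqrt (T : ℝ)) ∧
      ∀ T : ℕ, 0 < T →
        CAB.rateZF M P k - CAB.arCAB M P f α k T (CAB.trainLen M P f α T) ≤
          2 * Real.sqrt (M * CAB.lossINI M P f α / (f * T)) + ε T := by
  exact ⟨fun T hT => ⟨CAB.exists_isOptimalLen hP k hT, fun τ hτ =>
      sub_le_sub_left (hτ.2 (CAB.trainLen_mem_Ico k.pos hP hf hα hT)) _⟩,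
    CAB.exists_isLittleO_excess hP hf hα k⟩
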